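/- Let $L_1\in\mathbb{R}\setminus\{0\}$, $L_2=2L_1$, and on $\mathbb{R}^5$ with coordinates $(x_1,x_2,x_3,x_4,t)$ let $$X_j=\partial_{x_j}-L_jx_{j+2}\,\partial_t,\qquad X_{j+2}=\partial_{x_{j+2}}+L_jx_j\,\partial_t\qquad(j=1,2).$$ Let $G$ be the step-two Carnot group on $\mathbb{R}^5$ with identity $0$ for which these fields are left invariant, with first layer spanned by $X_1,\dots,X_4$, taken to be orthonormal, and second layer spanned by $\partial_t$; its dilations are $\delta_r(x,t)=(rx,r^2t)$ and its homogeneous dimension is $\mathcal{Q}=6$. Put $$\Delta_2f=\sum_{i=1}^4X_iX_if,\qquad \Delta_\infty f=\sum_{i,j=1}^4 X_if\,X_jf\,X_iX_jf.$$ Folland's fundamental solution of $\Delta_2u=0$ is the locally integrable function $u$, smooth on $G\setminus\{0\}$ and homogeneous of degree $2-\mathcal{Q}=-4$ under the dilations $\delta_r$, with $-\Delta_2u=\delta_0$ in the sense of distributions on $\mathbb{R}^5$, that is, $\int u\,\Delta_2\varphi=-\varphi(0)$ for every $\varphi\in C_c^\infty(\mathbb{R}^5)$. The group $G$ with this metric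 is called polarizable if $\Delta_\infty\bigl(u^{1/(2-\mathcal{Q})}\bigr)=0$ on $G\setminus\{0\}$ for this $u$. Set $$A=|L_1|\,(x_1^2+x_2^2+x_3^2+x_4^2),\qquad B=|L_1|\left(\tfrac12x_1^2+x_2^2+\tfrac12x_3^2+x_4^2\right),$$ $$N=\frac{(B^2+t^2)^{1/8}\,\bigl(A-B+\sqrt{B^2+t^2}\bigr)^{3/8}}{\bigl(B+\sqrt{B^2+t^2}\bigr)^{1/8}}.$$ Then there is a constant $C>0$ such that $CN^{-4}$ is Folland's fundamental solution of $\Delta_2u=0$, and it is the only one (as a function on $G\setminus\{0\}$). However, $\Delta_\infty N$ does not vanish identically on $G\setminus\{0\}$, and $G$ with this metric is not polarizable. -/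

import Mathlib

open MeasureTheory
open scoped ContDiff

namespace AnisoHeis

/-- The space `ℝ^{2n+1}` with points `(x, t)`. The coordinate `x_j` is `x (Sum.inl j)` and
the coordinate `x_{n+j}` is `x (Sum.inr j)`; the last factor is the vertical variable `t`. -/
abbrev Point (n : ℕ) : Type := (Fin n ⊕ Fin n → ℝ) × ℝ

/-- The group law
`(x,t) * (y,s) = (x + y, t + s + ∑ j, L_j (x_j y_{n+j} - y_j x_{n+j}))`,
which is the one that the vector fields below are left invariant for. -/
def mul {n : ℕ} (L : Fin n → ℝ) (p q : Point n) : Point n :=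
  (p.1 + q.1, p.2 + q.2 +
    ∑ j, L j * (p.1 (Sum.inl j) * q.1 (Sum.inr j) - q.1 (Sum.inl j) * p.1 (Sum.inr j)))

/-- The anisotropic Heisenberg group with parameters `L`; the identity is the origin. It is not
an instance, because `Point n` already has the componentwise multiplication. -/
@[reducible] def group {n : ℕ} (L : Fin n → ℝ) : Group (Point n) :=
  letI : Mul (Point n) := ⟨mul L⟩
  letI : One (Point n) := ⟨0⟩
  letI : Inv (Point n) := ⟨fun p => -p⟩
  Group.ofLeftAxioms
    (fun a b c => by
      change mul L (mul L a b) c = mul L a (mul L b c)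
      refine Prod.ext (add_assoc _ _ _) ?_
      simp only [mul, Pi.add_apply]
      simp only [add_mul, mul_add, mul_sub, Finset.sum_add_distrib, Finset.sum_sub_distrib]
      ring)
    (fun a => by
      change mul L 0 a = a
      refine Prod.ext ?_ ?_ <;> simp [mul])
    (fun a => by
      change mul L (-a) a = 0
      refine Prod.ext ?_ ?_
      · simp [mul]
      · simp only [mul, Prod.fst_neg, Prod.snd_neg, Pi.neg_apply, Prod.snd_zero]
        rw [neg_add_cancel, zero_add]
        exact Finset.sum_eq_zero fun j _ => by ring)

/-- The coefficient vectors of the generating vector fields: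
`X_j = ∂_{x_j} - L_j x_{n+j} ∂_t` and `X_{n+j} = ∂_{x_{n+j}} + L_j x_j ∂_t`, `1 ≤ j ≤ n`. -/
def field {n : ℕ} (L : Fin n → ℝ) (i : Fin n ⊕ Fin n) (p : Point n) : Point n :=
  (Pi.single i 1,
    match i with
    | Sum.inl j => -(L j * p.1 (Sum.inr j))
    | Sum.inr j => L j * p.1 (Sum.inl j))

/-- The horizontal derivative `X_i f`. -/
noncomputable def X {n : ℕ} (L : Fin n → ℝ) (i : Fin n ⊕ Fin n) (f : Point n → ℝ) :
    Point n → ℝ :=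
  fun p => fderiv ℝ f p (field L i p)

/-- The 2-Laplacian `Δ₂ f = ∑ i, X_i X_i f` for the metric in which the `X_i` are
orthonormal. -/
noncomputable def lap2 {n : ℕ} (L : Fin n → ℝ) (f : Point n → ℝ) (p : Point n) : ℝ :=
  ∑ i, X L i (X L i f) p

/-- The infinite Laplacian `Δ_∞ f = ∑ i j, (X_i f) (X_j f) (X_i X_j f)` for the metric in which
the `X_i` are orthonormal. -/
noncomputable def lapInf {n : ℕ} (L : Fin n → ℝ) (f : Point n → ℝ) (p : Point n) : ℝ :=
  ∑ i, ∑ j, X L i f p * X L j f p * X L i (X L j f) p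

/-- The homogeneous dimension `Q = 2n + 2`. -/
def homDim (n : ℕ) : ℝ := 2 * n + 2

/-- The dilation `δ_r (x, t) = (r x, r² t)`. -/
def dil {n : ℕ} (r : ℝ) (p : Point n) : Point n := (r • p.1, r ^ 2 * p.2)

/-- `u` is Folland's fundamental solution of the 2-Laplacian: smooth away from the identity,
homogeneous of degree `2 - Q`, locally integrable, and `-Δ₂ u = δ₀` in the sense of
distributions. (Each `X_i` is free of divergence, so `Δ₂` is formally self-adjoint with
respect to Lebesgue measure, which is the Haar measure.) The value `u 0` plays no role. -/
structure IsFollandSolution {n : ℕ} (L : Fin n → ℝ) (u : Point n → ℝ) : Prop where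
  smooth : ContDiffOn ℝ ∞ u {0}ᶜ
  homogeneous : ∀ r : ℝ, 0 < r → ∀ p : Point n, p ≠ 0 →
    u (dil r p) = r ^ (2 - homDim n) * u p
  locallyIntegrable : LocallyIntegrable u volume
  weak_eq : ∀ φ : Point n → ℝ, ContDiff ℝ ∞ φ → HasCompactSupport φ →
    ∫ p, u p * lap2 L φ p = - φ 0

/-- The group (`n ≥ 1`, all `L_j ≠ 0`), with the metric in which the `X_i` are orthonormal, is
polarizable: with `u` Folland's solution, `u ^ (1 / (2 - Q))` is infinity-harmonic away from
the identity. -/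
def IsPolarizable {n : ℕ} (L : Fin n → ℝ) : Prop :=
  ∃ u : Point n → ℝ, IsFollandSolution L u ∧
    ∀ p : Point n, p ≠ 0 → lapInf L (fun q => u q ^ (1 / (2 - homDim n))) p = 0

/-- The form `A = |L₁| (x₁² + x₂² + x₃² + x₄²)` on `ℝ⁵`. -/
def formA (L₁ : ℝ) (p : Point 2) : ℝ :=
  |L₁| * (p.1 (Sum.inl 0) ^ 2 + p.1 (Sum.inl 1) ^ 2 + p.1 (Sum.inr 0) ^ 2 + p.1 (Sum.inr 1) ^ 2)

/-- The form `B = |L₁| (x₁²/2 + x₂² + x₃²/2 + x₄²)` on `ℝ⁵`. -/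
noncomputable def formB (L₁ : ℝ) (p : Point 2) : ℝ :=
  |L₁| * (1 / 2 * p.1 (Sum.inl 0) ^ 2 + p.1 (Sum.inl 1) ^ 2
    + 1 / 2 * p.1 (Sum.inr 0) ^ 2 + p.1 (Sum.inr 1) ^ 2)

/-- The function
`N = (B² + t²)^{1/8} (A - B + √(B² + t²))^{3/8} / (B + √(B² + t²))^{1/8}`. -/
noncomputable def normN (L₁ : ℝ) (p : Point 2) : ℝ :=
  (formB L₁ p ^ 2 + p.2 ^ 2) ^ (1 / 8 : ℝ)
    * (formA L₁ p - formB L₁ p + √(formB L₁ p ^ 2 + p.2 ^ 2)) ^ (3 / 8 : ℝ)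
    / (formB L₁ p + √(formB L₁ p ^ 2 + p.2 ^ 2)) ^ (1 / 8 : ℝ)

/-- The vector fields `X_i` are left invariant for the group law. -/
theorem X_left_invariant {n : ℕ} (L : Fin n → ℝ) (i : Fin n ⊕ Fin n) (f : Point n → ℝ)
    (hf : Differentiable ℝ f) (q p : Point n) :
    X L i (fun z => f (mul L q z)) p = X L i f (mul L q p) := by
  let D : Point n →L[ℝ] Point n :=
    (ContinuousLinearMap.fst ℝ _ _).prod (ContinuousLinearMap.snd ℝ _ _ +
      ∑ j, L j • (q.1 (Sum.inl j) • (ContinuousLinearMap.proj (R := ℝ) (Sum.inr j)).comp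
          (ContinuousLinearMap.fst ℝ (Fin n ⊕ Fin n → ℝ) ℝ)
        - q.1 (Sum.inr j) • (ContinuousLinearMap.proj (R := ℝ) (Sum.inl j)).comp
          (ContinuousLinearMap.fst ℝ (Fin n ⊕ Fin n → ℝ) ℝ)))
  have hD : ∀ z, mul L q z = q + D z := by
    intro z
    refine Prod.ext ?_ ?_
    · simp [mul, D]
    · simp [mul, D, add_assoc, mul_comm]
  have h1 : HasFDerivAt (fun z => mul L q z) D p := by
    simp_rw [hD]
    exact D.hasFDerivAt.const_add q
  have h2 : fderiv ℝ (fun z => f (mul L q z)) p = (fderiv ℝ f (mul L q p)).comp D :=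
    ((hf _).hasFDerivAt.comp p h1).fderiv
  have h3 : D (field L i p) = field L i (mul L q p) := by
    refine Prod.ext ?_ ?_
    · simp [D, field]
    · rcases i with i | i <;>
        simp [D, field, mul, Pi.single_apply, mul_add] <;> ring
  simp only [X, h2, ContinuousLinearMap.comp_apply, h3]

end AnisoHeis

/-! Write Γ(f,g) = Σ X_i f · X_i g, D = A − B and R = √(B² + t²).

Harmonicity. Because L₂ = 2L₁, the pair B, t satisfies Γ(B,B) = Γ(t,t) and Γ(B,t) = 0, which also
forces Γ(R,R) = Γ(B,B). Hence Γ and Δ₂ of B, D, R are |L₁| times rational functions of B, D, R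
alone. Since N^{-4} = exp(−4 log N), its harmonicity off the origin means Δ₂ log N = 4 Γ(log N, log
N), which becomes a rational identity (`lap2_logN`).

Existence. Let u > 0 be harmonic off 0, homogeneous of degree 2 − Q = −2n, locally integrable,
infinite at 0 and at most 1 off a compact set. A smooth concave truncation v of u has Δ₂v ≤ 0,
compactly supported and not identically zero. The rescalings ε^{-2n} v(δ_{1/ε} p) converge to u,
while their Laplacians concentrate at 0; so −Δ₂u = cδ₀ with c = −∫Δ₂v > 0
(`exists_isFollandSolution`).

Uniqueness. Let w be another solution and k = w/u, homogeneous of degree 0. Then kw is homogeneous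
of degree 2 − Q and Δ₂(kw) = 2uΓ(k,k) ≥ 0. Scaling shows that the Laplacian of a function of this
degree has integral zero against every shell, so Γ(k,k) = 0 and k is constant
(`IsFollandSolution.eq_const_mul`). No maximum principle or hypoellipticity is needed.

Failure of polarizability. By uniqueness u^{-1/4} is a positive multiple of N, so one point
suffices: Δ_∞N is nonzero at (1,1,0,0;0) (`lapInf_normN_diagPoint`). -/

namespace AnisoHeis

open Filter Topology

section General

variable {n : ℕ} {L : Fin n → ℝ}

/-! ### Calculus of the horizontal fields -/

/-- The horizontal carré du champ `Γ(f, g) = ∑ i, X_i f X_i g`. -/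
noncomputable def gam {n : ℕ} (L : Fin n → ℝ) (f g : Point n → ℝ) (p : Point n) : ℝ :=
  ∑ i, X L i f p * X L i g p

theorem contDiff_field (L : Fin n → ℝ) (i : Fin n ⊕ Fin n) {m : WithTop ℕ∞} :
    ContDiff ℝ m (field L i) := by
  rcases i with j | j
  · refine contDiff_const.prodMk ?_
    change ContDiff ℝ m fun p : Point n => -(L j * p.1 (Sum.inr j))
    fun_prop
  · refine contDiff_const.prodMk ?_
    change ContDiff ℝ m fun p : Point n => L j * p.1 (Sum.inl j)
    fun_prop

theorem contDiffAt_X {f : Point n → ℝ} {p : Point n} {m k : WithTop ℕ∞}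
    (hf : ContDiffAt ℝ k f p) (h : m + 1 ≤ k) (i : Fin n ⊕ Fin n) :
    ContDiffAt ℝ m (X L i f) p :=
  (hf.fderiv_right h).clm_apply (contDiff_field L i).contDiffAt

theorem contDiffAt_two_X {f : Point n → ℝ} {p : Point n}
    (hf : ContDiffAt ℝ 2 f p) (i : Fin n ⊕ Fin n) :
    ContDiffAt ℝ 1 (X L i f) p :=
  contDiffAt_X hf (by norm_num [one_add_one_eq_two]) i

theorem contDiffAt_lap2 {f : Point n → ℝ} {p : Point n}
    (hf : ContDiffAt ℝ ∞ f p) : ContDiffAt ℝ ∞ (lap2 L f) p :=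
  ContDiffAt.sum fun i _ => contDiffAt_X (m := ∞) (contDiffAt_X (m := ∞) hf (by simp) i) (by simp) i

theorem contDiff_lap2 {f : Point n → ℝ}
    (hf : ContDiff ℝ ∞ f) : ContDiff ℝ ∞ (lap2 L f) :=
  contDiff_iff_contDiffAt.2 fun _ => contDiffAt_lap2 hf.contDiffAt

theorem contDiffAt_gam {f g : Point n → ℝ} {p : Point n} {m k : WithTop ℕ∞}
    (hf : ContDiffAt ℝ k f p) (hg : ContDiffAt ℝ k g p) (h : m + 1 ≤ k) :
    ContDiffAt ℝ m (gam L f g) p := by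
  change ContDiffAt ℝ m (fun q => ∑ i, X L i f q * X L i g q) p
  refine ContDiffAt.sum fun i _ => ?_
  exact (contDiffAt_X hf h i).mul (contDiffAt_X hg h i)

theorem X_congr {f g : Point n → ℝ} {p : Point n} (h : f =ᶠ[𝓝 p] g) (i : Fin n ⊕ Fin n) :
    X L i f =ᶠ[𝓝 p] X L i g := by
  filter_upwards [h.fderiv (𝕜 := ℝ)] with q hq
  simp [X, hq]

theorem lap2_congr {f g : Point n → ℝ} {p : Point n} (h : f =ᶠ[𝓝 p] g) :
    lap2 L f p = lap2 L g p :=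
  Finset.sum_congr rfl fun i _ => (X_congr (X_congr h i) i).eq_of_nhds

theorem gam_congr {f g f' g' : Point n → ℝ} {p : Point n} (h : f =ᶠ[𝓝 p] f')
    (h' : g =ᶠ[𝓝 p] g') : gam L f g p = gam L f' g' p :=
  Finset.sum_congr rfl fun i _ => by rw [(X_congr h i).eq_of_nhds, (X_congr h' i).eq_of_nhds]

theorem lapInf_congr {f g : Point n → ℝ} {p : Point n} (h : f =ᶠ[𝓝 p] g) :
    lapInf L f p = lapInf L g p :=
  Finset.sum_congr rfl fun i _ => Finset.sum_congr rfl fun j _ => by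
    rw [(X_congr h i).eq_of_nhds, (X_congr h j).eq_of_nhds, (X_congr (X_congr h j) i).eq_of_nhds]

theorem X_const (c : ℝ) (i : Fin n ⊕ Fin n) (p : Point n) : X L i (fun _ => c) p = 0 := by
  simp [X]

theorem X_add {f g : Point n → ℝ} {p : Point n} (hf : DifferentiableAt ℝ f p)
    (hg : DifferentiableAt ℝ g p) (i : Fin n ⊕ Fin n) :
    X L i (fun q => f q + g q) p = X L i f p + X L i g p := by
  simp [X, fderiv_fun_add hf hg]

theorem X_sub {f g : Point n → ℝ} {p : Point n} (hf : DifferentiableAt ℝ f p)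
    (hg : DifferentiableAt ℝ g p) (i : Fin n ⊕ Fin n) :
    X L i (fun q => f q - g q) p = X L i f p - X L i g p := by
  simp [X, fderiv_fun_sub hf hg]

theorem X_mul {f g : Point n → ℝ} {p : Point n} (hf : DifferentiableAt ℝ f p)
    (hg : DifferentiableAt ℝ g p) (i : Fin n ⊕ Fin n) :
    X L i (fun q => f q * g q) p = f p * X L i g p + g p * X L i f p := by
  simp [X, fderiv_fun_mul hf hg]

theorem X_const_mul {f : Point n → ℝ} {p : Point n} (hf : DifferentiableAt ℝ f p) (c : ℝ)
    (i : Fin n ⊕ Fin n) : X L i (fun q => c * f q) p = c * X L i f p := by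
  rw [X_mul (differentiableAt_const c) hf, X_const]; ring

theorem X_sum {ι : Type*} {s : Finset ι} {f : ι → Point n → ℝ} {p : Point n}
    (hf : ∀ j ∈ s, DifferentiableAt ℝ (f j) p) (i : Fin n ⊕ Fin n) :
    X L i (fun q => ∑ j ∈ s, f j q) p = ∑ j ∈ s, X L i (f j) p := by
  simp [X, fderiv_fun_sum hf]

theorem X_comp {f : Point n → ℝ} {p : Point n} {φ : ℝ → ℝ} {φ' : ℝ} (hφ : HasDerivAt φ φ' (f p))
    (hf : DifferentiableAt ℝ f p) (i : Fin n ⊕ Fin n) :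
    X L i (fun q => φ (f q)) p = φ' * X L i f p := by
  have h : HasFDerivAt (fun q => φ (f q)) (φ' • fderiv ℝ f p) p :=
    hφ.comp_hasFDerivAt p hf.hasFDerivAt
  simp [X, h.fderiv]

theorem eventually_differentiableAt {f : Point n → ℝ} {p : Point n} (hf : ContDiffAt ℝ 2 f p) :
    ∀ᶠ q in 𝓝 p, DifferentiableAt ℝ f q :=
  (hf.eventually (by simp)).mono fun _ h => h.differentiableAt (by simp)

theorem lap2_add {f g : Point n → ℝ} {p : Point n} (hf : ContDiffAt ℝ 2 f p)
    (hg : ContDiffAt ℝ 2 g p) :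
    lap2 L (fun q => f q + g q) p = lap2 L f p + lap2 L g p := by
  simp only [lap2, ← Finset.sum_add_distrib]
  refine Finset.sum_congr rfl fun i _ => ?_
  have h : X L i (fun q => f q + g q) =ᶠ[𝓝 p] fun q => X L i f q + X L i g q := by
    filter_upwards [eventually_differentiableAt hf, eventually_differentiableAt hg] with q h1 h2
    exact X_add h1 h2 i
  rw [(X_congr h i).eq_of_nhds, X_add ((contDiffAt_two_X hf i).differentiableAt (by simp))
    ((contDiffAt_two_X hg i).differentiableAt (by simp))]

theorem lap2_mul {f g : Point n → ℝ} {p : Point n} (hf : ContDiffAt ℝ 2 f p)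
    (hg : ContDiffAt ℝ 2 g p) :
    lap2 L (fun q => f q * g q) p = f p * lap2 L g p + 2 * gam L f g p + g p * lap2 L f p := by
  simp only [lap2, gam, Finset.mul_sum, ← Finset.sum_add_distrib]
  refine Finset.sum_congr rfl fun i _ => ?_
  have h : X L i (fun q => f q * g q) =ᶠ[𝓝 p] fun q => f q * X L i g q + g q * X L i f q := by
    filter_upwards [eventually_differentiableAt hf, eventually_differentiableAt hg] with q h1 h2
    exact X_mul h1 h2 i
  have hf0 := hf.differentiableAt (by simp)
  have hg0 := hg.differentiableAt (by simp)
  have hf1 := (contDiffAt_two_X (L := L) hf i).differentiableAt (by simp)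
  have hg1 := (contDiffAt_two_X (L := L) hg i).differentiableAt (by simp)
  rw [(X_congr h i).eq_of_nhds, X_add (hf0.fun_mul hg1) (hg0.fun_mul hf1), X_mul hf0 hg1, X_mul hg0 hf1]
  ring

theorem lap2_const (c : ℝ) (p : Point n) : lap2 L (fun _ => c) p = 0 := by
  have h : ∀ i, X L i (fun _ => c) = fun _ => 0 := fun i => funext fun q => X_const c i q
  simp [lap2, h, X_const]

theorem lap2_const_mul {f : Point n → ℝ} {p : Point n} (hf : ContDiffAt ℝ 2 f p) (c : ℝ) :
    lap2 L (fun q => c * f q) p = c * lap2 L f p := by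
  rw [lap2_mul contDiffAt_const hf, lap2_const]
  simp [gam, X_const]

theorem lap2_comp {f : Point n → ℝ} {p : Point n} {φ φ' : ℝ → ℝ} {φ'' : ℝ}
    (hφ : ∀ᶠ s in 𝓝 (f p), HasDerivAt φ (φ' s) s) (hφ' : HasDerivAt φ' φ'' (f p))
    (hf : ContDiffAt ℝ 2 f p) :
    lap2 L (fun q => φ (f q)) p = φ' (f p) * lap2 L f p + φ'' * gam L f f p := by
  simp only [lap2, gam, Finset.mul_sum, ← Finset.sum_add_distrib]
  refine Finset.sum_congr rfl fun i _ => ?_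
  have h : X L i (fun q => φ (f q)) =ᶠ[𝓝 p] fun q => φ' (f q) * X L i f q := by
    filter_upwards [eventually_differentiableAt hf, hf.continuousAt.eventually hφ] with q h1 h2
    exact X_comp h2 h1 i
  have hf0 := hf.differentiableAt (by simp)
  have hf1 := (contDiffAt_two_X (L := L) hf i).differentiableAt (by simp)
  have h2 : DifferentiableAt ℝ (fun q => φ' (f q)) p := hφ'.differentiableAt.comp p hf0
  rw [(X_congr h i).eq_of_nhds, X_mul h2 hf1, X_comp hφ' hf0]
  ring

theorem gam_comm (f g : Point n → ℝ) (p : Point n) : gam L f g p = gam L g f p :=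
  Finset.sum_congr rfl fun _ _ => mul_comm _ _

theorem gam_self_nonneg (f : Point n → ℝ) (p : Point n) : 0 ≤ gam L f f p :=
  Finset.sum_nonneg fun _ _ => mul_self_nonneg _

theorem gam_add_right {f g h : Point n → ℝ} {p : Point n} (hg : DifferentiableAt ℝ g p)
    (hh : DifferentiableAt ℝ h p) :
    gam L f (fun q => g q + h q) p = gam L f g p + gam L f h p := by
  simp only [gam, X_add hg hh, ← Finset.sum_add_distrib, mul_add]

theorem gam_mul_right {f g h : Point n → ℝ} {p : Point n} (hg : DifferentiableAt ℝ g p)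
    (hh : DifferentiableAt ℝ h p) :
    gam L f (fun q => g q * h q) p = g p * gam L f h p + h p * gam L f g p := by
  simp only [gam, X_mul hg hh, ← Finset.sum_add_distrib, Finset.mul_sum]
  exact Finset.sum_congr rfl fun _ _ => by ring

theorem gam_const_mul_right {f g : Point n → ℝ} {p : Point n} (hg : DifferentiableAt ℝ g p)
    (c : ℝ) : gam L f (fun q => c * g q) p = c * gam L f g p := by
  simp only [gam, X_const_mul hg, Finset.mul_sum]
  exact Finset.sum_congr rfl fun _ _ => by ring

theorem gam_comp_right {f g : Point n → ℝ} {p : Point n} {φ : ℝ → ℝ} {φ' : ℝ}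
    (hφ : HasDerivAt φ φ' (g p)) (hg : DifferentiableAt ℝ g p) :
    gam L f (fun q => φ (g q)) p = φ' * gam L f g p := by
  simp only [gam, X_comp hφ hg, Finset.mul_sum]
  exact Finset.sum_congr rfl fun _ _ => by ring

/-- Applying X_i to Γ(f,f) = Σ_j (X_j f)² gives 2 Σ_j X_j f · X_i X_j f. The fields come in the same
order as in Δ_∞, so no commutator appears. -/
theorem lapInf_eq_gam {f : Point n → ℝ} {p : Point n} (hf : ContDiffAt ℝ 2 f p) :
    lapInf L f p = 1 / 2 * gam L f (gam L f f) p := by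
  have hX : ∀ j, DifferentiableAt ℝ (X L j f) p := fun j =>
    (contDiffAt_two_X hf j).differentiableAt (by simp)
  have h : ∀ i, X L i (gam L f f) p = ∑ j, 2 * (X L j f p * X L i (X L j f) p) := by
    intro i
    have := X_sum (L := L) (s := Finset.univ) (f := fun j q => X L j f q * X L j f q)
      (fun j _ => (hX j).mul (hX j)) i
    refine this.trans (Finset.sum_congr rfl fun j _ => ?_)
    rw [X_mul (hX j) (hX j)]; ring
  simp only [lapInf, gam, Finset.mul_sum] at h ⊢
  refine Finset.sum_congr rfl fun i _ => ?_
  rw [h, Finset.mul_sum, Finset.mul_sum]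
  exact Finset.sum_congr rfl fun j _ => by ring

theorem lapInf_const_mul {f : Point n → ℝ} {p : Point n} (hf : ContDiffAt ℝ 2 f p) (c : ℝ) :
    lapInf L (fun q => c * f q) p = c ^ 3 * lapInf L f p := by
  have h1 : ∀ i, X L i (fun q => c * f q) =ᶠ[𝓝 p] fun q => c * X L i f q := by
    intro i
    filter_upwards [eventually_differentiableAt hf] with q hq
    exact X_const_mul hq c i
  have hX : ∀ j, DifferentiableAt ℝ (X L j f) p := fun j =>
    (contDiffAt_two_X hf j).differentiableAt (by simp)
  simp only [lapInf, Finset.mul_sum]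
  refine Finset.sum_congr rfl fun i _ => Finset.sum_congr rfl fun j _ => ?_
  rw [(h1 i).eq_of_nhds, (h1 j).eq_of_nhds, (X_congr (h1 j) i).eq_of_nhds, X_const_mul (hX j)]
  ring

/-! ### Dilations -/

/-- The dilation as a linear map. -/
noncomputable def dilLin (n : ℕ) (r : ℝ) : Point n →L[ℝ] Point n :=
  (r • ContinuousLinearMap.id ℝ _).prodMap (r ^ 2 • ContinuousLinearMap.id ℝ _)

theorem dilLin_apply (r : ℝ) (p : Point n) : dilLin n r p = dil r p := by
  rfl

theorem contDiff_dil (r : ℝ) {m : WithTop ℕ∞} : ContDiff ℝ m (dil r : Point n → Point n) := by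
  rw [show (dil r : Point n → Point n) = dilLin n r from funext fun p => (dilLin_apply r p).symm]
  exact (dilLin n r).contDiff

theorem dil_zero (r : ℝ) : dil r (0 : Point n) = 0 := by simp [dil]

theorem dil_dil (r s : ℝ) (p : Point n) : dil r (dil s p) = dil (r * s) p := by
  simp [dil, smul_smul, mul_pow, mul_assoc]

theorem dil_one (p : Point n) : dil 1 p = p := by simp [dil]

theorem dil_inv_dil {r : ℝ} (hr : r ≠ 0) (p : Point n) : dil r⁻¹ (dil r p) = p := by
  rw [dil_dil, inv_mul_cancel₀ hr, dil_one]

theorem dil_ne_zero {r : ℝ} (hr : r ≠ 0) {p : Point n} (hp : p ≠ 0) : dil r p ≠ 0 := by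
  intro h
  apply hp
  rw [← dil_inv_dil hr p, h, dil_zero]

/-- The ∂_t-coefficient of X_i is linear in x and t has weight two, so X_i is homogeneous of degree
one. -/
theorem field_dil (r : ℝ) (i : Fin n ⊕ Fin n) (p : Point n) :
    dil r (field L i p) = r • field L i (dil r p) := by
  rcases i with j | j <;> refine Prod.ext rfl ?_ <;> simp [dil, field] <;> ring

theorem X_comp_dil {f : Point n → ℝ} {p : Point n} {r : ℝ} (hf : DifferentiableAt ℝ f (dil r p))
    (i : Fin n ⊕ Fin n) : X L i (fun q => f (dil r q)) p = r * X L i f (dil r p) := by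
  have h : HasFDerivAt (fun q => f (dil r q)) ((fderiv ℝ f (dil r p)).comp (dilLin n r)) p := by
    have h2 : HasFDerivAt (dil r) (dilLin n r) p := by
      have := (dilLin n r).hasFDerivAt (x := p)
      exact this.congr_of_eventuallyEq (Eventually.of_forall fun q => (dilLin_apply r q).symm)
    exact hf.hasFDerivAt.comp p h2
  simp [X, h.fderiv, dilLin_apply, field_dil]

theorem lap2_comp_dil {f : Point n → ℝ} (hf : ContDiff ℝ 2 f) (p : Point n) (r : ℝ) :
    lap2 L (fun q => f (dil r q)) p = r ^ 2 * lap2 L f (dil r p) := by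
  have hd : Differentiable ℝ (dil r : Point n → Point n) := (contDiff_dil r).differentiable one_ne_zero
  simp only [lap2, Finset.mul_sum]
  refine Finset.sum_congr rfl fun i _ => ?_
  have h : X L i (fun q => f (dil r q)) = fun q => r * X L i f (dil r q) :=
    funext fun q => X_comp_dil (hf.differentiable (by simp) _) i
  have hX : Differentiable ℝ (X L i f) := fun q =>
    (contDiffAt_two_X hf.contDiffAt i).differentiableAt (by simp)
  rw [h, X_const_mul (f := fun q => X L i f (dil r q)) ((hX _).comp p (hd p)), X_comp_dil (hX _)]
  ring

instance isAddHaarMeasure_volume_point : (volume : Measure (Point n)).IsAddHaarMeasure :=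
  inferInstanceAs ((volume : Measure (Fin n ⊕ Fin n → ℝ)).prod (volume : Measure ℝ)).IsAddHaarMeasure

theorem det_dilLin (r : ℝ) :
    LinearMap.det (dilLin n r : Point n →ₗ[ℝ] Point n) = r ^ (2 * n + 2) := by
  have h : (dilLin n r : Point n →ₗ[ℝ] Point n) =
    LinearMap.prodMap (r • LinearMap.id) (r ^ 2 • LinearMap.id) := rfl
  rw [h, LinearMap.det_prodMap]
  simp
  ring

/-- The Jacobian of δ_r is r^{2n+2}, the exponent being the homogeneous dimension. -/
theorem integral_comp_dil (f : Point n → ℝ) {r : ℝ} (hr : 0 < r) :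
    ∫ p, f (dil r p) = (r ^ (2 * n + 2))⁻¹ * ∫ p, f p := by
  have hdet : LinearMap.det (dilLin n r : Point n →ₗ[ℝ] Point n) ≠ 0 := by
    rw [det_dilLin]; positivity
  have hm := Measure.map_linearMap_addHaar_eq_smul_addHaar (volume : Measure (Point n)) hdet
  rw [det_dilLin, abs_of_pos (by positivity)] at hm
  have he : MeasurableEmbedding (dilLin n r : Point n → Point n) := by
    let e := (LinearEquiv.ofIsUnitDet (f := (dilLin n r : Point n →ₗ[ℝ] Point n))
      (v := Module.finBasis ℝ _) (v' := Module.finBasis ℝ _)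
      (by rw [LinearMap.det_toMatrix]; exact hdet.isUnit)).toContinuousLinearEquiv
    exact e.toHomeomorph.measurableEmbedding
  have h2 := he.integral_map (μ := volume) f
  have h3 : Measure.map (dilLin n r : Point n → Point n) volume
    = ENNReal.ofReal (r ^ (2 * n + 2))⁻¹ • volume := hm
  rw [h3, integral_smul_measure, ENNReal.toReal_ofReal (by positivity)] at h2
  simp only [dilLin_apply] at h2
  rw [← h2, smul_eq_mul]

/-! ### Integration by parts -/

/-- The ∂_t-coefficient of X_i does not depend on t, so X_i is divergence free; integrate by parts
in the two constant directions separately. -/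
theorem integral_X_eq_zero {h : Point n → ℝ} (hh : ContDiff ℝ 1 h) (hc : HasCompactSupport h)
    (i : Fin n ⊕ Fin n) : ∫ p, X L i h p = 0 := by
  have hcont : Continuous (fderiv ℝ h) := hh.continuous_fderiv (by simp)
  have hcs : HasCompactSupport (fderiv ℝ h) := hc.fderiv ℝ
  have hd : Differentiable ℝ h := hh.differentiable (by simp)
  have hint : ∀ (c : Point n → ℝ) (v : Point n), Continuous c →
      Integrable (fun p => c p * fderiv ℝ h p v) := by
    intro c v hcc
    refine (hcc.mul (hcont.clm_apply continuous_const)).integrable_of_hasCompactSupport ?_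
    exact (hcs.comp_left (g := fun T : Point n →L[ℝ] ℝ => T v) rfl).mul_left
  have key : ∀ (c : Point n → ℝ) (v : Point n), ContDiff ℝ 1 c → (∀ p, fderiv ℝ c p v = 0) →
      ∫ p, c p * fderiv ℝ h p v = 0 := by
    intro c v hcc hv
    have := integral_mul_fderiv_eq_neg_fderiv_mul_of_integrable (μ := (volume : Measure (Point n)))
      (f := c) (g := h) (v := v) (by simp [hv]) (hint c v hcc.continuous)
      ((hcc.continuous.mul hh.continuous).integrable_of_hasCompactSupport hc.mul_left)
      (fun x _ => hcc.differentiable (by simp) x) (fun x _ => hd x)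
    rw [this]; simp [hv]
  have hc2 : ContDiff ℝ 1 fun p : Point n => (field L i p).2 := contDiff_snd.comp (contDiff_field L i)
  have hsplit : ∀ p, X L i h p =
      1 * fderiv ℝ h p (Pi.single i 1, 0) + (field L i p).2 * fderiv ℝ h p (0, 1) := by
    intro p
    have : field L i p = ((Pi.single i 1, 0) : Point n) + (field L i p).2 • ((0, 1) : Point n) := by
      refine Prod.ext ?_ ?_ <;> simp [field]
    rw [X, this, map_add, map_smul]
    simp
  simp_rw [hsplit]
  rw [integral_add (hint _ _ continuous_const) (hint _ _ hc2.continuous),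
    key (fun _ => 1) _ contDiff_const (by simp), key _ _ hc2, add_zero]
  intro p
  rcases i with j | j
  · have h1 : HasFDerivAt (fun p : Point n => (field L (Sum.inl j) p).2)
        (-(L j • (ContinuousLinearMap.proj (R := ℝ) (Sum.inr j)).comp
          (ContinuousLinearMap.fst ℝ (Fin n ⊕ Fin n → ℝ) ℝ))) p := by
      exact ((((ContinuousLinearMap.proj (R := ℝ) (Sum.inr j)).comp
        (ContinuousLinearMap.fst ℝ (Fin n ⊕ Fin n → ℝ) ℝ)).hasFDerivAt (x := p)).const_smul (L j)).neg
    rw [h1.fderiv]; simp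
  · have h1 : HasFDerivAt (fun p : Point n => (field L (Sum.inr j) p).2)
        (L j • (ContinuousLinearMap.proj (R := ℝ) (Sum.inl j)).comp
          (ContinuousLinearMap.fst ℝ (Fin n ⊕ Fin n → ℝ) ℝ)) p := by
      exact (((ContinuousLinearMap.proj (R := ℝ) (Sum.inl j)).comp
        (ContinuousLinearMap.fst ℝ (Fin n ⊕ Fin n → ℝ) ℝ)).hasFDerivAt (x := p)).const_smul (L j)
    rw [h1.fderiv]; simp

theorem tsupport_X_subset (f : Point n → ℝ) (i : Fin n ⊕ Fin n) :
    tsupport (X L i f) ⊆ tsupport f := by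
  refine (closure_mono ?_).trans (tsupport_fderiv_subset ℝ (f := f))
  intro p hp h
  exact hp (by simp [X, h])

theorem tsupport_lap2_subset (f : Point n → ℝ) : tsupport (lap2 L f) ⊆ tsupport f := by
  refine closure_minimal ?_ (isClosed_tsupport f)
  intro p hp
  by_contra h
  refine hp (Finset.sum_eq_zero fun i _ => image_eq_zero_of_notMem_tsupport fun h2 => h ?_)
  exact tsupport_X_subset _ i (tsupport_X_subset _ i h2)

theorem hasCompactSupport_lap2 {f : Point n → ℝ} (hf : HasCompactSupport f) :
    HasCompactSupport (lap2 L f) :=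
  hf.of_isClosed_subset (isClosed_tsupport _) (tsupport_lap2_subset f)

theorem contDiff_mul_of_tsupport_subset {a b : Point n → ℝ} {U : Set (Point n)} {m : WithTop ℕ∞}
    (hU : IsOpen U) (ha : ContDiffOn ℝ m a U) (hb : ContDiff ℝ m b) (hbU : tsupport b ⊆ U) :
    ContDiff ℝ m (fun p => a p * b p) := by
  refine contDiff_iff_contDiffAt.2 fun p => ?_
  by_cases hp : p ∈ tsupport b
  · exact (ha.contDiffAt (hU.mem_nhds (hbU hp))).mul hb.contDiffAt
  · have h0 : (fun q => a q * b q) =ᶠ[𝓝 p] fun _ => 0 := by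
      filter_upwards [(isClosed_tsupport b).isOpen_compl.mem_nhds hp] with q hq
      rw [image_eq_zero_of_notMem_tsupport hq, mul_zero]
    exact contDiffAt_const.congr_of_eventuallyEq h0

/-- Green's identity: fΔ₂g − gΔ₂f = Σ X_i(f X_i g − g X_i f), a sum of derivatives of compactly
supported functions. Only `f` may be singular, and only away from the support of `g`. -/
theorem integral_mul_lap2_comm {f g : Point n → ℝ} {U : Set (Point n)} (hU : IsOpen U)
    (hf : ContDiffOn ℝ ∞ f U) (hg : ContDiff ℝ ∞ g) (hc : HasCompactSupport g)
    (hgU : tsupport g ⊆ U) :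
    Integrable (fun p => lap2 L f p * g p) ∧
      ∫ p, f p * lap2 L g p = ∫ p, lap2 L f p * g p := by
  have smooth_mul : ∀ a b : Point n → ℝ, ContDiffOn ℝ ∞ a U → ContDiff ℝ ∞ b →
      tsupport b ⊆ tsupport g → ContDiff ℝ ∞ (fun p => a p * b p) :=
    fun a b ha hb hbg => contDiff_mul_of_tsupport_subset hU ha hb (hbg.trans hgU)
  have cs : ∀ a b : Point n → ℝ, tsupport b ⊆ tsupport g → HasCompactSupport (fun p => a p * b p) :=
    fun a b hb => HasCompactSupport.mul_left (hc.of_isClosed_subset (isClosed_tsupport _) hb)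
  have hXf : ∀ i, ContDiffOn ℝ ∞ (X L i f) U := fun i p hp =>
    (contDiffAt_X (hf.contDiffAt (hU.mem_nhds hp)) (by simp) i).contDiffWithinAt
  have hlf : ContDiffOn ℝ ∞ (lap2 L f) U := fun p hp =>
    (contDiffAt_lap2 (hf.contDiffAt (hU.mem_nhds hp))).contDiffWithinAt
  have hXg : ∀ i, ContDiff ℝ ∞ (X L i g) := fun i =>
    contDiff_iff_contDiffAt.2 fun p => contDiffAt_X hg.contDiffAt (by simp) i
  have hXs := fun i => tsupport_X_subset (L := L) g i
  have i1 : Integrable (fun p => lap2 L f p * g p) :=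
    (smooth_mul _ _ hlf hg subset_rfl).continuous.integrable_of_hasCompactSupport
      (cs _ _ subset_rfl)
  have i2 : Integrable (fun p => f p * lap2 L g p) :=
    (smooth_mul _ _ hf (contDiff_lap2 hg)
      (tsupport_lap2_subset g)).continuous.integrable_of_hasCompactSupport
      (cs _ _ (tsupport_lap2_subset g))
  refine ⟨i1, ?_⟩
  rw [← sub_eq_zero, ← integral_sub i2 i1]
  have hF : ∀ i, ContDiff ℝ ∞ (fun p => f p * X L i g p - X L i f p * g p) := fun i =>
    (smooth_mul _ _ hf (hXg i) (hXs i)).sub (smooth_mul _ _ (hXf i) hg subset_rfl)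
  have hFc : ∀ i, HasCompactSupport (fun p => f p * X L i g p - X L i f p * g p) := fun i => by
    have := HasCompactSupport.add (cs f _ (hXs i)) (cs (fun p => - X L i f p) g subset_rfl)
    refine (congrArg HasCompactSupport (funext fun p => ?_)).mp this
    simp [sub_eq_add_neg]
  have hpt : ∀ p, f p * lap2 L g p - lap2 L f p * g p =
      ∑ i, X L i (fun p => f p * X L i g p - X L i f p * g p) p := by
    intro p
    by_cases hp : p ∈ tsupport g
    · have hfp := hf.contDiffAt (hU.mem_nhds (hgU hp))
      have d1 := hfp.differentiableAt (by simp)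
      have d2 := fun i => (contDiffAt_X (L := L) (m := ∞) hfp (by simp) i).differentiableAt (by simp)
      have d3 := hg.differentiable (by simp) p
      have d4 := fun i => (hXg i).differentiable (by simp) p
      simp only [lap2, Finset.mul_sum, Finset.sum_mul, ← Finset.sum_sub_distrib]
      refine Finset.sum_congr rfl fun i _ => ?_
      rw [X_sub (d1.fun_mul (d4 i)) ((d2 i).fun_mul d3), X_mul d1 (d4 i), X_mul (d2 i) d3]
      ring
    · have h0 : ∀ i, (fun p => f p * X L i g p - X L i f p * g p) =ᶠ[𝓝 p] fun _ => 0 := by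
        intro i
        filter_upwards [(isClosed_tsupport g).isOpen_compl.mem_nhds hp] with q hq
        rw [image_eq_zero_of_notMem_tsupport hq,
          image_eq_zero_of_notMem_tsupport fun h => hq (hXs i h)]
        simp
      rw [Finset.sum_eq_zero fun i _ => by rw [(X_congr (h0 i) i).eq_of_nhds, X_const],
        image_eq_zero_of_notMem_tsupport hp,
        image_eq_zero_of_notMem_tsupport fun h => hp (tsupport_lap2_subset g h)]
      simp
  simp_rw [hpt]
  rw [integral_finsetSum]
  · exact Finset.sum_eq_zero fun i _ => integral_X_eq_zero ((hF i).of_le (by simp)) (hFc i) i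
  · intro i _
    have : ContDiff ℝ ∞ (X L i (fun p => f p * X L i g p - X L i f p * g p)) :=
      contDiff_iff_contDiffAt.2 fun p => contDiffAt_X (hF i).contDiffAt (by simp) i
    exact this.continuous.integrable_of_hasCompactSupport
      ((hFc i).of_isClosed_subset (isClosed_tsupport _) (tsupport_X_subset _ i))

theorem two_le_infty : (2 : WithTop ℕ∞) ≤ ∞ := ENat.LEInfty.out

/-! ### Homogeneous functions -/

/-- `f` is homogeneous of degree `d` away from the origin. -/
def IsHomog {n : ℕ} (f : Point n → ℝ) (d : ℤ) : Prop :=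
  ∀ r : ℝ, 0 < r → ∀ p : Point n, p ≠ 0 → f (dil r p) = r ^ d * f p

theorem IsHomog.mul {f g : Point n → ℝ} {d e : ℤ} (hf : IsHomog f d) (hg : IsHomog g e) :
    IsHomog (fun p => f p * g p) (d + e) := fun r hr p hp => by
  simp only [hf r hr p hp, hg r hr p hp, zpow_add₀ hr.ne']; ring

theorem IsHomog.div {f g : Point n → ℝ} {d e : ℤ} (hf : IsHomog f d) (hg : IsHomog g e) :
    IsHomog (fun p => f p / g p) (d - e) := fun r hr p hp => by
  simp only [hf r hr p hp, hg r hr p hp, zpow_sub₀ hr.ne', mul_div_mul_comm]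

theorem rpow_two_sub_homDim {r : ℝ} : r ^ (2 - homDim n) = r ^ (-(2 * n : ℤ)) := by
  rw [← Real.rpow_intCast]
  congr 1
  simp [homDim]

/-- Differentiate r ↦ f(δ_r p) at r = 1; the velocity of the dilation orbit is (x, 2t). -/
theorem IsHomog.euler {f : Point n → ℝ} {d : ℤ} (hf : IsHomog f d) {p : Point n} (hp : p ≠ 0)
    (hd : DifferentiableAt ℝ f p) : fderiv ℝ f p (p.1, 2 * p.2) = d * f p := by
  have hcurve : HasDerivAt (fun r : ℝ => dil r p) (p.1, 2 * p.2) 1 := by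
    have h1 : HasDerivAt (fun r : ℝ => r • p.1) p.1 1 := by
      simpa using (hasDerivAt_id (1 : ℝ)).smul_const p.1
    have h2 : HasDerivAt (fun r : ℝ => r ^ 2 * p.2) (2 * p.2) 1 := by
      simpa using (hasDerivAt_pow 2 (1 : ℝ)).mul_const p.2
    exact h1.prodMk h2
  have h1 : HasDerivAt (fun r : ℝ => f (dil r p)) (fderiv ℝ f p (p.1, 2 * p.2)) 1 := by
    have hd' : HasFDerivAt f (fderiv ℝ f p) (dil 1 p) := by
      rw [dil_one]; exact hd.hasFDerivAt
    exact hd'.comp_hasDerivAt 1 hcurve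
  have h2 : HasDerivAt (fun r : ℝ => f (dil r p)) (d * f p) 1 := by
    have h3 : HasDerivAt (fun r : ℝ => r ^ d * f p) (d * f p) 1 := by
      simpa using (hasDerivAt_zpow d (1 : ℝ) (Or.inl one_ne_zero)).mul_const (f p)
    refine h3.congr_of_eventuallyEq ?_
    filter_upwards [lt_mem_nhds (zero_lt_one' ℝ)] with r hr using hf r hr p hp
  exact h1.unique h2

theorem fst_sum_smul_field (x : Fin n ⊕ Fin n → ℝ) (p : Point n) :
    (∑ i, x i • field L i p).1 = x := by
  ext k
  rw [Prod.fst_sum, Finset.sum_apply]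
  simp only [field, Prod.smul_fst, Pi.smul_apply, Pi.single_apply, smul_eq_mul, mul_ite, mul_one,
    mul_zero, Finset.sum_ite_eq, Finset.mem_univ, if_true]

theorem sum_smul_field (p : Point n) : ∑ i, p.1 i • field L i p = (p.1, 0) := by
  refine Prod.ext (fst_sum_smul_field _ _) ?_
  rw [Prod.snd_sum]
  simp only [Fintype.sum_sum_type, field, Prod.smul_snd, smul_eq_mul]
  rw [← Finset.sum_add_distrib]
  exact Finset.sum_eq_zero fun j _ => by ring

theorem sum_mul_X (f : Point n → ℝ) (p : Point n) :
    ∑ i, p.1 i * X L i f p = fderiv ℝ f p (p.1, 0) := by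
  simp only [← sum_smul_field (L := L) p, map_sum, map_smul, X, smul_eq_mul]

theorem X_eq_zero_of_gam_eq_zero {f : Point n → ℝ} {p : Point n} (h : gam L f f p = 0)
    (i : Fin n ⊕ Fin n) : X L i f p = 0 :=
  mul_self_eq_zero.1
    ((Finset.sum_eq_zero_iff_of_nonneg fun _ _ => mul_self_nonneg _).1 h i (Finset.mem_univ i))

/-- On t = 0 the Euler field is horizontal, equal to Σ x_i X_i, so a vanishing horizontal gradient
would force d·f = 0. -/
theorem IsHomog.gam_pos {f : Point n → ℝ} {d : ℤ} (hf : IsHomog f d) {p : Point n} (hp : p ≠ 0)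
    (hd : DifferentiableAt ℝ f p) (ht : p.2 = 0) (hdf : (d : ℝ) * f p ≠ 0) :
    0 < gam L f f p := by
  refine lt_of_le_of_ne (gam_self_nonneg f p) fun h => hdf ?_
  rw [← hf.euler hp hd, ht, mul_zero, ← sum_mul_X (L := L)]
  exact Finset.sum_eq_zero fun i _ => by rw [X_eq_zero_of_gam_eq_zero h.symm, mul_zero]

/-- A homogeneous function of degree `0` without horizontal gradient is constant away from the
origin. -/
theorem IsHomog.eq_const {f : Point n → ℝ} (hn : 0 < n) (hf : IsHomog f 0)
    (hs : ContDiffOn ℝ ∞ f {0}ᶜ) (h : ∀ p ≠ 0, gam L f f p = 0) :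
    ∃ M, ∀ p ≠ 0, f p = M := by
  have hat : ∀ p ≠ 0, ContDiffAt ℝ ∞ f p := fun p hp =>
    hs.contDiffAt (isOpen_compl_singleton.mem_nhds hp)
  have h1 : ∀ p : Point n, p.2 ≠ 0 → fderiv ℝ f p = 0 := by
    intro p hp
    have hp0 : p ≠ 0 := fun h0 => hp (by simp [h0])
    have hX := fun i => X_eq_zero_of_gam_eq_zero (h p hp0) i
    have e1 : fderiv ℝ f p (p.1, 0) = 0 := by
      rw [← sum_mul_X (L := L)]; simp [hX]
    have e2 := hf.euler hp0 ((hat p hp0).differentiableAt (by simp))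
    -- The Euler field is Σ x_i X_i + 2t ∂_t. Both it and the X_i annihilate f, so ∂_t f = 0 where t
    -- ≠ 0, and the X_i with ∂_t span all directions.
    have e3 : ((p.1, 2 * p.2) : Point n) = (p.1, 0) + (2 * p.2) • ((0, 1) : Point n) := by
      refine Prod.ext ?_ ?_ <;> simp
    rw [e3, map_add, e1, map_smul] at e2
    have e4 : fderiv ℝ f p (0, 1) = 0 := by simpa [hp] using e2
    refine ContinuousLinearMap.ext fun v => ?_
    have e5 : v = ∑ i, v.1 i • field L i p +
        (v.2 - (∑ i, v.1 i • field L i p).2) • ((0, 1) : Point n) := by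
      refine Prod.ext ?_ ?_
      · rw [Prod.fst_add, fst_sum_smul_field]; simp
      · simp
    rw [e5, map_add, map_smul, e4, map_sum, smul_zero, add_zero]
    refine Finset.sum_eq_zero fun i _ => ?_
    rw [map_smul, show fderiv ℝ f p (field L i p) = 0 from hX i, smul_zero]
  -- The hyperplane t = 0 is reached by continuity of the derivative along vertical lines.
  have h2 : ∀ p : Point n, p ≠ 0 → fderiv ℝ f p = 0 := by
    intro p hp
    by_cases hp2 : p.2 = 0
    · have hc : ContinuousAt (fderiv ℝ f) p :=
        ((hat p hp).fderiv_right (m := 0) (by simp)).continuousAt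
      have hcur : Tendsto (fun s : ℝ => ((p.1, s) : Point n)) (𝓝[≠] 0) (𝓝 p) := by
        have : Tendsto (fun s : ℝ => ((p.1, s) : Point n)) (𝓝 0) (𝓝 (p.1, 0)) :=
          Continuous.tendsto (by fun_prop) 0
        rw [show p = (p.1, 0) from Prod.ext rfl hp2]
        exact this.mono_left nhdsWithin_le_nhds
      refine tendsto_nhds_unique (hc.tendsto.comp hcur) (tendsto_const_nhds.congr' ?_)
      filter_upwards [self_mem_nhdsWithin] with s hs using (h1 (p.1, s) hs).symm
    · exact h1 p hp2
  have hconn : IsPreconnected ({0}ᶜ : Set (Point n)) := by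
    refine (isConnected_compl_singleton_of_one_lt_rank ?_ 0).isPreconnected
    rw [← Module.finrank_eq_rank]
    have : Module.finrank ℝ (Point n) = n + n + 1 := by simp
    rw [this]
    exact_mod_cast (by omega : 1 < n + n + 1)
  obtain ⟨M, hM⟩ := isOpen_compl_singleton.exists_is_const_of_fderiv_eq_zero (𝕜 := ℝ) hconn
    (fun p hp => ((hat p hp).differentiableAt (by simp)).differentiableWithinAt)
    (fun p hp => h2 p hp)
  exact ⟨M, hM⟩

/-! ### Cutoff functions -/

/-- A smooth gauge, homogeneous of degree `4`. -/
def gauge4 {n : ℕ} (p : Point n) : ℝ := (∑ i, p.1 i ^ 2) ^ 2 + p.2 ^ 2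

theorem contDiff_gauge4 {m : WithTop ℕ∞} : ContDiff ℝ m (gauge4 : Point n → ℝ) := by
  unfold gauge4; fun_prop

theorem gauge4_dil (r : ℝ) (p : Point n) : gauge4 (dil r p) = r ^ 4 * gauge4 p := by
  simp [gauge4, dil, mul_pow, ← Finset.mul_sum]
  ring

theorem gauge4_nonneg (p : Point n) : 0 ≤ gauge4 p := by unfold gauge4; positivity

theorem gauge4_pos {p : Point n} (hp : p ≠ 0) : 0 < gauge4 p := by
  refine lt_of_le_of_ne (gauge4_nonneg p) fun h => hp ?_
  unfold gauge4 at h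
  have h1 : (∑ i, p.1 i ^ 2) ^ 2 = 0 := by nlinarith [sq_nonneg (∑ i, p.1 i ^ 2), sq_nonneg p.2]
  have h2 : p.2 ^ 2 = 0 := by nlinarith [sq_nonneg (∑ i, p.1 i ^ 2), sq_nonneg p.2]
  refine Prod.ext (funext fun i => ?_) (by simpa using h2)
  have := (Finset.sum_eq_zero_iff_of_nonneg fun i _ => sq_nonneg (p.1 i)).1
    (pow_eq_zero_iff two_ne_zero |>.1 h1) i (Finset.mem_univ i)
  simpa using this

theorem isCompact_of_sq_le {K : Set (Point n)} (hK : IsClosed K) (C : ℝ)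
    (h : ∀ p ∈ K, (∀ i, p.1 i ^ 2 ≤ C) ∧ p.2 ^ 2 ≤ C) : IsCompact K := by
  refine Metric.isCompact_of_isClosed_isBounded hK
    ((Metric.isBounded_closedBall (x := (0 : Point n)) (r := √C)).subset fun p hp => ?_)
  rw [mem_closedBall_zero_iff]
  obtain ⟨h1, h2⟩ := h p hp
  refine (Prod.norm_def p).trans_le (max_le ?_ ?_)
  · exact (pi_norm_le_iff_of_nonneg (Real.sqrt_nonneg _)).2 fun i => Real.abs_le_sqrt (h1 i)
  · exact Real.abs_le_sqrt h2

theorem isCompact_gauge4_le (C : ℝ) : IsCompact {p : Point n | gauge4 p ≤ C} := by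
  refine isCompact_of_sq_le
    (isClosed_le (contDiff_gauge4 (m := 0)).continuous continuous_const) (C + 1) fun p hp => ?_
  have hp' : (∑ i, p.1 i ^ 2) ^ 2 + p.2 ^ 2 ≤ C := hp
  refine ⟨fun i => ?_, by nlinarith [sq_nonneg (∑ i, p.1 i ^ 2)]⟩
  have : p.1 i ^ 2 ≤ ∑ i, p.1 i ^ 2 :=
    Finset.single_le_sum (f := fun i => p.1 i ^ 2) (fun i _ => sq_nonneg _) (Finset.mem_univ i)
  -- With S = Σ x_i², S ≤ S² + 1/4 ≤ C + 1/4; this is why the bound is C + 1.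
  nlinarith [sq_nonneg (∑ i, p.1 i ^ 2 - 1 / 2), sq_nonneg p.2]

/-- The cutoff, equal to `1` where `c * gauge4 ≤ 1` and to `0` where `2 ≤ c * gauge4`. -/
noncomputable def cutoff {n : ℕ} (c : ℝ) (p : Point n) : ℝ :=
  Real.smoothTransition (2 - c * gauge4 p)

theorem contDiff_cutoff (c : ℝ) : ContDiff ℝ ∞ (cutoff c : Point n → ℝ) :=
  Real.smoothTransition.contDiff.comp (contDiff_const.sub (contDiff_const.mul contDiff_gauge4))

theorem hasCompactSupport_cutoff {c : ℝ} (hc : 0 < c) :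
    HasCompactSupport (cutoff c : Point n → ℝ) := by
  refine HasCompactSupport.intro (isCompact_gauge4_le (2 / c)) fun p hp => ?_
  refine Real.smoothTransition.zero_of_nonpos ?_
  have : 2 / c < gauge4 p := not_le.1 hp
  rw [div_lt_iff₀ hc] at this
  linarith

/-- The difference of two dilated cutoffs, supported in a shell. -/
noncomputable def shell {n : ℕ} (c : ℝ) (p : Point n) : ℝ := cutoff c p - cutoff c (dil 2 p)

theorem contDiff_shell (c : ℝ) : ContDiff ℝ ∞ (shell c : Point n → ℝ) :=
  (contDiff_cutoff c).sub ((contDiff_cutoff c).comp (contDiff_dil 2))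

theorem shell_nonneg {c : ℝ} (hc : 0 < c) (p : Point n) : 0 ≤ shell c p := by
  refine sub_nonneg.2 (Real.smoothTransition.monotone ?_)
  rw [gauge4_dil]
  nlinarith [mul_nonneg hc.le (gauge4_nonneg p)]

theorem eventually_cutoff_eq_one (c : ℝ) : ∀ᶠ p : Point n in 𝓝 0, cutoff c p = 1 := by
  have h : Continuous fun p : Point n => c * gauge4 p :=
    continuous_const.mul (contDiff_gauge4 (m := 0)).continuous
  have h0 : c * gauge4 (0 : Point n) < 1 := by simp [gauge4]
  filter_upwards [h.continuousAt.eventually (gt_mem_nhds h0)] with p hp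
  exact Real.smoothTransition.one_of_one_le (by linarith)

theorem cutoff_comp_dil (c r : ℝ) : (fun p : Point n => cutoff c (dil r p)) = cutoff (c * r ^ 4) := by
  ext p
  simp [cutoff, gauge4_dil, mul_assoc]

theorem tsupport_shell_subset (c : ℝ) : tsupport (shell c : Point n → ℝ) ⊆ {0}ᶜ := by
  intro p hp h0
  rw [Set.mem_singleton_iff] at h0
  subst h0
  refine (notMem_tsupport_iff_eventuallyEq.2 ?_) hp
  filter_upwards [eventually_cutoff_eq_one c, eventually_cutoff_eq_one (c * 2 ^ 4)] with p h1 h2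
  rw [← cutoff_comp_dil] at h2
  simp only [shell, h1, h2, sub_self, Pi.zero_apply]

theorem hasCompactSupport_shell {c : ℝ} (hc : 0 < c) :
    HasCompactSupport (shell c : Point n → ℝ) := by
  have h := HasCompactSupport.add (hasCompactSupport_cutoff (n := n) hc)
    (HasCompactSupport.neg (hasCompactSupport_cutoff (n := n) (c := c * 2 ^ 4) (by positivity)))
  refine (congrArg HasCompactSupport (funext fun p => ?_)).mp h
  simp [shell, ← cutoff_comp_dil, sub_eq_add_neg]

/-- At this scale the two smooth transitions are evaluated at 1 and −14. Thus every point off the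
origin is seen by some shell. -/
theorem shell_eq_one {p : Point n} (hp : p ≠ 0) : shell (gauge4 p)⁻¹ p = 1 := by
  have h := (gauge4_pos hp).ne'
  simp only [shell, cutoff, gauge4_dil]
  rw [Real.smoothTransition.one_of_one_le, Real.smoothTransition.zero_of_nonpos, sub_zero]
  · field_simp; norm_num
  · rw [inv_mul_cancel₀ h]; norm_num

/-! ### Uniqueness -/

theorem eq_zero_of_integral_mul_shell_eq_zero {f : Point n → ℝ} (hf : ContinuousOn f {0}ᶜ)
    (hf0 : ∀ p ≠ 0, 0 ≤ f p) (h : ∀ c > 0, ∫ p, f p * shell c p = 0) :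
    ∀ p ≠ 0, f p = 0 := by
  intro p hp
  by_contra hne
  have hc : 0 < (gauge4 p)⁻¹ := inv_pos.2 (gauge4_pos hp)
  have hcont : Continuous fun q => f q * shell (gauge4 p)⁻¹ q :=
    contDiff_zero.1 (contDiff_mul_of_tsupport_subset isOpen_compl_singleton (contDiffOn_zero.2 hf)
      ((contDiff_shell _).of_le (by simp)) (tsupport_shell_subset _))
  refine (hcont.integral_pos_of_hasCompactSupport_nonneg_nonzero (μ := volume) (x := p)
    (hasCompactSupport_shell hc).mul_left ?_ ?_).ne' (h _ hc)
  · intro q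
    by_cases hq : q = 0
    · have : shell (gauge4 p)⁻¹ q = 0 := by
        refine image_eq_zero_of_notMem_tsupport fun h => tsupport_shell_subset _ h hq
      simp [this]
    · exact mul_nonneg (hf0 q hq) (shell_nonneg hc q)
  · rw [shell_eq_one hp, mul_one]; exact hne

theorem contDiffOn_lap2 {f : Point n → ℝ} {U : Set (Point n)} (hU : IsOpen U)
    (hf : ContDiffOn ℝ ∞ f U) : ContDiffOn ℝ ∞ (lap2 L f) U := fun _ hp =>
  (contDiffAt_lap2 (hf.contDiffAt (hU.mem_nhds hp))).contDiffWithinAt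

theorem IsFollandSolution.isHomog {u : Point n → ℝ} (hu : IsFollandSolution L u) :
    IsHomog u (-(2 * n : ℤ)) := fun r hr p hp => by
  rw [hu.homogeneous r hr p hp, rpow_two_sub_homDim]

/-- Test the weak equation with Δ₂u times a shell: this is an admissible function vanishing at 0,
and Green's identity turns the equation into ∫ (Δ₂u)² · shell = 0. -/
theorem IsFollandSolution.lap2_eq_zero {u : Point n → ℝ} (hu : IsFollandSolution L u)
    {p : Point n} (hp : p ≠ 0) : lap2 L u p = 0 := by
  have hl := contDiffOn_lap2 (L := L) isOpen_compl_singleton hu.smooth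
  refine mul_self_eq_zero.1 (eq_zero_of_integral_mul_shell_eq_zero
    (f := fun p => lap2 L u p * lap2 L u p) (hl.mul hl).continuousOn
    (fun _ _ => mul_self_nonneg _) (fun c hc => ?_) p hp)
  have hφ : ContDiff ℝ ∞ fun p => lap2 L u p * shell c p :=
    contDiff_mul_of_tsupport_subset isOpen_compl_singleton hl (contDiff_shell c)
      (tsupport_shell_subset c)
  have hφs : tsupport (fun p => lap2 L u p * shell c p) ⊆ tsupport (shell c) :=
    tsupport_mul_subset_right
  have hφc : HasCompactSupport fun p => lap2 L u p * shell c p :=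
    (hasCompactSupport_shell hc).mul_left
  have h1 := hu.weak_eq _ hφ hφc
  rw [(integral_mul_lap2_comm isOpen_compl_singleton hu.smooth hφ hφc
    (hφs.trans (tsupport_shell_subset c))).2] at h1
  simp_rw [mul_assoc]
  rw [h1, image_eq_zero_of_notMem_tsupport fun h => tsupport_shell_subset c h rfl]
  simp

/-- The flux through large and small shells agrees. Move Δ₂ onto shell = χ − χ∘δ₂; the powers of 2
from f, from Δ₂ and from the Jacobian cancel exactly in degree 2 − Q, so χ and χ∘δ₂ contribute
equally. Each integral converges because Δ₂χ vanishes near the origin. -/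
theorem integral_lap2_mul_shell_eq_zero {f : Point n → ℝ} (hs : ContDiffOn ℝ ∞ f {0}ᶜ)
    (hf : IsHomog f (-(2 * n : ℤ))) {c : ℝ} (hc : 0 < c) :
    ∫ p, lap2 L f p * shell c p = 0 := by
  rw [← (integral_mul_lap2_comm isOpen_compl_singleton hs (contDiff_shell c)
    (hasCompactSupport_shell hc) (tsupport_shell_subset c)).2]
  have hcut : ∀ c > 0, Integrable fun p => f p * lap2 L (cutoff c) p := by
    intro c hc
    have hsub : tsupport (lap2 L (cutoff c)) ⊆ {0}ᶜ := by
      intro p hp h0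
      rw [Set.mem_singleton_iff] at h0
      subst h0
      refine (notMem_tsupport_iff_eventuallyEq.2 ?_) hp
      filter_upwards [(eventually_cutoff_eq_one c).eventually_nhds] with q hq
      rw [lap2_congr (g := fun _ => 1) hq, lap2_const]; rfl
    exact (contDiff_mul_of_tsupport_subset isOpen_compl_singleton hs
      (contDiff_lap2 (contDiff_cutoff c)) hsub).continuous.integrable_of_hasCompactSupport
      (HasCompactSupport.mul_left (hasCompactSupport_lap2 (hasCompactSupport_cutoff hc)))
  have hsplit : ∀ p, f p * lap2 L (shell c) p =
      f p * lap2 L (cutoff c) p - f p * lap2 L (fun q => cutoff c (dil 2 q)) p := by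
    intro p
    have h1 : lap2 L (shell c) p =
        lap2 L (fun q => cutoff c q + (-1) * cutoff c (dil 2 q)) p := by
      congr 1; ext q; simp [shell, sub_eq_add_neg]
    have h2 : ContDiff ℝ 2 fun q : Point n => cutoff c (dil 2 q) :=
      ((contDiff_cutoff c).comp (contDiff_dil 2)).of_le two_le_infty
    rw [h1, lap2_add ((contDiff_cutoff c).of_le two_le_infty).contDiffAt
      (contDiff_const.mul h2).contDiffAt, lap2_const_mul h2.contDiffAt]
    ring
  simp_rw [hsplit]
  rw [integral_sub (hcut c hc) (by rw [cutoff_comp_dil]; exact hcut _ (by positivity)), sub_eq_zero]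
  have hae : (fun p => f p * lap2 L (fun q => cutoff c (dil 2 q)) p) =ᵐ[volume]
      fun p => (2 : ℝ) ^ (2 * n + 2) * (f (dil 2 p) * lap2 L (cutoff c) (dil 2 p)) := by
    filter_upwards [Measure.ae_ne volume (0 : Point n)] with p hp
    rw [lap2_comp_dil ((contDiff_cutoff c).of_le two_le_infty), hf 2 two_pos p hp]
    rw [zpow_neg, pow_add, show ((2 : ℝ) ^ (2 * n : ℤ)) = 2 ^ (2 * n) by norm_cast]
    field_simp
  rw [integral_congr_ae hae, integral_const_mul,
    integral_comp_dil (fun p => f p * lap2 L (cutoff c) p) two_pos, ← mul_assoc,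
    mul_inv_cancel₀ (by positivity), one_mul]

/-- With k = w/u, harmonicity of w = ku and u gives uΔ₂k + 2Γ(k,u) = 0. Inserting this into the
product rule for kw leaves only the term with Γ(k,k). -/
theorem lap2_div_mul {u w : Point n → ℝ} {p : Point n} (hu : ContDiffAt ℝ 2 u p)
    (hw : ContDiffAt ℝ 2 w p) (hup : u p ≠ 0) (hlu : lap2 L u p = 0) (hlw : lap2 L w p = 0) :
    lap2 L (fun q => w q / u q * w q) p =
      2 * u p * gam L (fun q => w q / u q) (fun q => w q / u q) p := by
  set k : Point n → ℝ := fun q => w q / u q with hk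
  have hkc : ContDiffAt ℝ 2 k p := hw.div hu hup
  have hwk : w =ᶠ[𝓝 p] fun q => k q * u q := by
    filter_upwards [hu.continuousAt.eventually_ne hup] with q hq
    rw [hk]; field_simp
  have e1 : k p * lap2 L u p + 2 * gam L k u p + u p * lap2 L k p = 0 := by
    rw [← lap2_mul hkc hu, ← lap2_congr hwk, hlw]
  have e2 : gam L k w p = k p * gam L k u p + u p * gam L k k p := by
    rw [gam_congr (EventuallyEq.refl _ k) hwk, gam_mul_right (hkc.differentiableAt (by simp))
      (hu.differentiableAt (by simp))]
  have e3 : w p = k p * u p := hwk.eq_of_nhds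
  rw [lap2_mul hkc hw, hlw, e2, e3]
  rw [hlu] at e1
  linear_combination k p * e1

/-- The auxiliary function (w/u)·w = w²/u has the degree 2 − Q for which shell integrals of the
Laplacian vanish, and its Laplacian has a sign whatever the sign of w. -/
theorem IsFollandSolution.eq_const_mul {u w : Point n → ℝ} (hn : 0 < n)
    (hw : IsFollandSolution L w) (hs : ContDiffOn ℝ ∞ u {0}ᶜ) (hu : IsHomog u (-(2 * n : ℤ)))
    (hpos : ∀ p ≠ 0, 0 < u p) (hl : ∀ p ≠ 0, lap2 L u p = 0) :
    ∃ M, ∀ p ≠ 0, w p = M * u p := by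
  have hks : ContDiffOn ℝ ∞ (fun q => w q / u q) {0}ᶜ :=
    hw.smooth.div hs fun p hp => (hpos p hp).ne'
  have hkh : IsHomog (fun q => w q / u q) 0 := by simpa using hw.isHomog.div hu
  have hfs : ContDiffOn ℝ ∞ (fun q => w q / u q * w q) {0}ᶜ := hks.mul hw.smooth
  have hfh : IsHomog (fun q => w q / u q * w q) (-(2 * n : ℤ)) := by
    simpa using hkh.mul hw.isHomog
  have hlf : ∀ p ≠ 0, lap2 L (fun q => w q / u q * w q) p =
      2 * u p * gam L (fun q => w q / u q) (fun q => w q / u q) p := fun p hp =>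
    lap2_div_mul ((hs.contDiffAt (isOpen_compl_singleton.mem_nhds hp)).of_le two_le_infty)
      ((hw.smooth.contDiffAt (isOpen_compl_singleton.mem_nhds hp)).of_le two_le_infty)
      (hpos p hp).ne' (hl p hp) (hw.lap2_eq_zero hp)
  have hz := eq_zero_of_integral_mul_shell_eq_zero
    (contDiffOn_lap2 (L := L) isOpen_compl_singleton hfs).continuousOn
    (fun p hp => by
      rw [hlf p hp]
      exact mul_nonneg (mul_nonneg zero_le_two (hpos p hp).le) (gam_self_nonneg _ _))
    (fun c hc => integral_lap2_mul_shell_eq_zero hfs hfh hc)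
  obtain ⟨M, hM⟩ := hkh.eq_const hn hks (L := L) fun p hp => by
    have := hz p hp
    rw [hlf p hp] at this
    simpa [(hpos p hp).ne'] using this
  refine ⟨M, fun p hp => ?_⟩
  rw [← hM p hp, div_mul_cancel₀ _ (hpos p hp).ne']

theorem IsFollandSolution.unique {u w : Point n → ℝ} (hn : 0 < n)
    (hu : IsFollandSolution L u) (hw : IsFollandSolution L w) (hpos : ∀ p ≠ 0, 0 < u p) :
    ∀ p ≠ 0, w p = u p := by
  obtain ⟨M, hM⟩ := hw.eq_const_mul hn hu.smooth hu.isHomog hpos fun p hp => hu.lap2_eq_zero hp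
  -- A test function equal to 1 at the origin determines the constant M.
  have h0 : cutoff 1 (0 : Point n) = 1 := (eventually_cutoff_eq_one 1).self_of_nhds
  have h1 := hu.weak_eq _ (contDiff_cutoff 1) (hasCompactSupport_cutoff one_pos)
  have h2 := hw.weak_eq _ (contDiff_cutoff 1) (hasCompactSupport_cutoff one_pos)
  have h3 : (fun p => w p * lap2 L (cutoff 1) p) =ᵐ[volume]
      fun p => M * (u p * lap2 L (cutoff 1) p) := by
    filter_upwards [Measure.ae_ne volume (0 : Point n)] with p hp
    rw [hM p hp, mul_assoc]
  rw [integral_congr_ae h3, integral_const_mul, h1, h0] at h2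
  intro p hp
  rw [hM p hp, show M = 1 by linarith, one_mul]

/-! ### A concave truncation -/

/-- A smooth concave function, equal to the identity on `(-∞, 1]` and constant on `[2, ∞)`. -/
noncomputable def trunc (s : ℝ) : ℝ := ∫ x in (0 : ℝ)..s, Real.smoothTransition (2 - x)

theorem contDiff_truncDeriv : ContDiff ℝ ∞ fun s : ℝ => Real.smoothTransition (2 - s) :=
  Real.smoothTransition.contDiff.comp (contDiff_const.sub contDiff_id)

theorem hasDerivAt_trunc (s : ℝ) : HasDerivAt trunc (Real.smoothTransition (2 - s)) s :=
  contDiff_truncDeriv.continuous.integral_hasStrictDerivAt 0 s |>.hasDerivAt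

theorem contDiff_trunc : ContDiff ℝ ∞ trunc := by
  refine contDiff_infty_iff_deriv.2 ⟨fun s => (hasDerivAt_trunc s).differentiableAt, ?_⟩
  rw [show deriv trunc = fun s => Real.smoothTransition (2 - s) from
    funext fun s => (hasDerivAt_trunc s).deriv]
  exact contDiff_truncDeriv

theorem trunc_of_le_one {s : ℝ} (hs : s ≤ 1) : trunc s = s := by
  have h : Set.EqOn (fun x => Real.smoothTransition (2 - x)) (fun _ => 1) (Set.uIcc 0 s) := by
    intro x hx
    refine Real.smoothTransition.one_of_one_le ?_
    have := hx.2
    have : max 0 s ≤ 1 := max_le zero_le_one hs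
    linarith
  rw [trunc, intervalIntegral.integral_congr h]
  simp

theorem trunc_of_two_le {s : ℝ} (hs : 2 ≤ s) : trunc s = trunc 2 := by
  have h2 : ∫ x in (2 : ℝ)..s, Real.smoothTransition (2 - x) = 0 := by
    rw [intervalIntegral.integral_congr (g := fun _ => 0)]
    · simp
    · intro x hx
      refine Real.smoothTransition.zero_of_nonpos ?_
      rw [Set.uIcc_of_le hs] at hx
      linarith [hx.1]
  have hi : ∀ a b : ℝ, IntervalIntegrable (fun x => Real.smoothTransition (2 - x)) volume a b :=
    fun a b => contDiff_truncDeriv.continuous.intervalIntegrable a b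
  rw [trunc, ← intervalIntegral.integral_add_adjacent_intervals (hi 0 2) (hi 2 s), h2, add_zero,
    trunc]

theorem trunc_nonneg {s : ℝ} (hs : 0 ≤ s) : 0 ≤ trunc s :=
  intervalIntegral.integral_nonneg hs fun _ _ => Real.smoothTransition.nonneg _

theorem trunc_le {s : ℝ} (hs : 0 ≤ s) : trunc s ≤ s := by
  have h := intervalIntegral.integral_mono_on hs
    (contDiff_truncDeriv.continuous.intervalIntegrable 0 s)
    (continuous_const.intervalIntegrable (μ := volume) 0 s)
    fun x _ => Real.smoothTransition.le_one (2 - x)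
  simpa [trunc] using h

theorem deriv_truncDeriv_nonpos (s : ℝ) :
    deriv (fun s : ℝ => Real.smoothTransition (2 - s)) s ≤ 0 := by
  have h : Antitone fun s : ℝ => Real.smoothTransition (2 - s) := fun a b hab =>
    Real.smoothTransition.monotone (by linarith)
  exact h.deriv_nonpos

/-- The first derivative of the truncation drops from 1 to 0 on [1, 2]. Strict concavity somewhere
is what keeps the total mass of Δ₂v from being zero. -/
theorem exists_deriv_truncDeriv_neg :
    ∃ s > 0, deriv (fun s : ℝ => Real.smoothTransition (2 - s)) s < 0 := by
  obtain ⟨s, hs, h⟩ := exists_deriv_eq_slope (fun s : ℝ => Real.smoothTransition (2 - s))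
    one_lt_two contDiff_truncDeriv.continuous.continuousOn
    (contDiff_truncDeriv.differentiable (by simp)).differentiableOn
  refine ⟨s, by linarith [hs.1], ?_⟩
  rw [h, Real.smoothTransition.zero_of_nonpos (by norm_num),
    Real.smoothTransition.one_of_one_le (by norm_num)]
  norm_num

/-! ### Existence -/

/-- The truncation of `u`, extended across the origin. -/
noncomputable def truncAt {n : ℕ} (u : Point n → ℝ) (p : Point n) : ℝ :=
  open scoped Classical in if p = 0 then trunc 2 else trunc (u p)

theorem truncAt_of_ne {u : Point n → ℝ} {p : Point n} (hp : p ≠ 0) :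
    truncAt u p = trunc (u p) := if_neg hp

theorem truncAt_eventuallyEq {u : Point n → ℝ} {p : Point n} (hp : p ≠ 0) :
    truncAt u =ᶠ[𝓝 p] fun q => trunc (u q) := by
  filter_upwards [isOpen_compl_singleton.mem_nhds hp] with q hq using truncAt_of_ne hq

theorem truncAt_eventuallyEq_zero {u : Point n → ℝ} (h0 : Tendsto u (𝓝[≠] 0) atTop) :
    truncAt u =ᶠ[𝓝 0] fun _ => trunc 2 := by
  have := h0.eventually_ge_atTop 2
  rw [eventually_nhdsWithin_iff] at this
  filter_upwards [this] with p hp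
  by_cases h : p = 0
  · simp [truncAt, h]
  · rw [truncAt_of_ne h, trunc_of_two_le (hp h)]

theorem contDiff_truncAt {u : Point n → ℝ} (hs : ContDiffOn ℝ ∞ u {0}ᶜ)
    (h0 : Tendsto u (𝓝[≠] 0) atTop) : ContDiff ℝ ∞ (truncAt u) := by
  refine contDiff_iff_contDiffAt.2 fun p => ?_
  by_cases hp : p = 0
  · subst hp
    exact contDiffAt_const.congr_of_eventuallyEq (truncAt_eventuallyEq_zero h0)
  · exact (contDiff_trunc.contDiffAt.comp p
      (hs.contDiffAt (isOpen_compl_singleton.mem_nhds hp))).congr_of_eventuallyEq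
      (truncAt_eventuallyEq hp)

theorem lap2_truncAt {u : Point n → ℝ} (hs : ContDiffOn ℝ ∞ u {0}ᶜ)
    (hl : ∀ p ≠ 0, lap2 L u p = 0) {p : Point n} (hp : p ≠ 0) :
    lap2 L (truncAt u) p =
      deriv (fun s : ℝ => Real.smoothTransition (2 - s)) (u p) * gam L u u p := by
  rw [lap2_congr (truncAt_eventuallyEq hp), lap2_comp (φ := trunc)
    (Eventually.of_forall hasDerivAt_trunc)
    (contDiff_truncDeriv.differentiable (by simp) (u p)).hasDerivAt
    ((hs.contDiffAt (isOpen_compl_singleton.mem_nhds hp)).of_le two_le_infty), hl p hp]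
  ring

/-- Blow-up at 0 makes the truncation v constant near 0, hence smooth there; the bound u ≤ 1 off K
makes it equal to u there, hence harmonic. So Δ₂v is a smooth compactly supported density, and its
rescalings form an approximate multiple of δ₀. -/
theorem exists_isFollandSolution {u : Point n → ℝ} (hn : 0 < n)
    (hs : ContDiffOn ℝ ∞ u {0}ᶜ) (hu : IsHomog u (-(2 * n : ℤ))) (hpos : ∀ p ≠ 0, 0 < u p)
    (hl : ∀ p ≠ 0, lap2 L u p = 0) (hloc : LocallyIntegrable u)
    (h0 : Tendsto u (𝓝[≠] 0) atTop) {K : Set (Point n)} (hK : IsCompact K)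
    (hinf : ∀ p ∉ K, u p ≤ 1) :
    ∃ C > 0, IsFollandSolution L fun p => C * u p := by
  have hv := contDiff_truncAt hs h0
  have hg : ContDiff ℝ ∞ (lap2 L (truncAt u)) := contDiff_lap2 hv
  have hg0 : lap2 L (truncAt u) 0 = 0 := by
    rw [lap2_congr (truncAt_eventuallyEq_zero h0), lap2_const]
  have hgc : HasCompactSupport (lap2 L (truncAt u)) := by
    refine HasCompactSupport.intro hK fun p hp => ?_
    by_cases hp0 : p = 0
    · rw [hp0, hg0]
    · have h1 : truncAt u =ᶠ[𝓝 p] u := by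
        filter_upwards [isOpen_compl_singleton.mem_nhds hp0, hK.isClosed.isOpen_compl.mem_nhds hp]
          with q hq hqK
        rw [truncAt_of_ne hq, trunc_of_le_one (hinf q hqK)]
      rw [lap2_congr h1, hl p hp0]
  have hgneg : ∀ p, lap2 L (truncAt u) p ≤ 0 := by
    intro p
    by_cases hp0 : p = 0
    · rw [hp0, hg0]
    · rw [lap2_truncAt hs hl hp0]
      exact mul_nonpos_of_nonpos_of_nonneg (deriv_truncDeriv_nonpos _) (gam_self_nonneg _ _)
  obtain ⟨p₀, hp₀⟩ : ∃ p, lap2 L (truncAt u) p ≠ 0 := by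
    obtain ⟨s, hs0, hds⟩ := exists_deriv_truncDeriv_neg
    let q : Point n := (Pi.single (Sum.inl ⟨0, hn⟩) 1, 0)
    have hq : q ≠ 0 := by
      intro h
      have := congrFun (congrArg Prod.fst h) (Sum.inl ⟨0, hn⟩)
      simp [q] at this
    -- Homogeneity of degree −2n gives u(δ_r q) = s for this r. The point stays on t = 0, where
    -- `IsHomog.gam_pos` applies.
    set r : ℝ := (u q / s) ^ ((2 * n : ℝ)⁻¹) with hr
    have hus : 0 < u q / s := div_pos (hpos q hq) hs0
    have hr0 : 0 < r := Real.rpow_pos_of_pos hus _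
    have hrn : r ^ (2 * n) = u q / s := by
      rw [← Real.rpow_natCast, hr, ← Real.rpow_mul hus.le]
      push_cast
      rw [inv_mul_cancel₀ (by positivity), Real.rpow_one]
    have hur : u (dil r q) = s := by
      rw [hu r hr0 q hq, zpow_neg, show r ^ (2 * n : ℤ) = r ^ (2 * n) by norm_cast, hrn]
      have := (hpos q hq).ne'
      field_simp
    have hne := dil_ne_zero hr0.ne' hq
    refine ⟨dil r q, ?_⟩
    rw [lap2_truncAt hs hl hne, hur]
    refine mul_ne_zero hds.ne (ne_of_gt ?_)
    refine hu.gam_pos hne ((hs.contDiffAt (isOpen_compl_singleton.mem_nhds hne)).differentiableAt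
      (by simp)) (by simp [dil, q]) ?_
    rw [hur]
    refine mul_ne_zero ?_ hs0.ne'
    push_cast
    exact neg_ne_zero.2 (by positivity)
  set c : ℝ := ∫ p, -lap2 L (truncAt u) p with hc
  have hcpos : 0 < c :=
    hg.neg.continuous.integral_pos_of_hasCompactSupport_nonneg_nonzero (μ := volume) (x := p₀)
      hgc.neg (fun p => neg_nonneg.2 (hgneg p)) (neg_ne_zero.2 hp₀)
  have hweak : ∀ φ : Point n → ℝ, ContDiff ℝ ∞ φ → HasCompactSupport φ →
      ∫ p, u p * lap2 L φ p = -(c * φ 0) := by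
    intro φ hφ hφc
    -- Green's identity for v against φ∘δ_ε, followed by the change of variables δ_ε, which
    -- contributes ε²·ε^{-(2n+2)} = ε^{-2n}.
    have hgreen : ∀ ε : ℝ, 0 < ε →
        ∫ p, ε ^ (-(2 * n : ℤ)) * truncAt u (dil ε⁻¹ p) * lap2 L φ p =
          ∫ p, lap2 L (truncAt u) p * φ (dil ε p) := by
      intro ε hε
      have hφε : ContDiff ℝ ∞ fun p => φ (dil ε p) := hφ.comp (contDiff_dil ε)
      have hφεc : HasCompactSupport fun p => φ (dil ε p) := by
        have hcont : Continuous (dil ε⁻¹ : Point n → Point n) :=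
          (contDiff_dil (m := 0) _).continuous
        refine HasCompactSupport.intro (hφc.image hcont) fun p hp => ?_
        refine image_eq_zero_of_notMem_tsupport fun h => hp ?_
        exact ⟨dil ε p, h, dil_inv_dil hε.ne' p⟩
      rw [← (integral_mul_lap2_comm isOpen_univ hv.contDiffOn hφε hφεc (Set.subset_univ _)).2]
      have e : ∀ p, truncAt u p * lap2 L (fun q => φ (dil ε q)) p = ε ^ 2 *
          (fun q => truncAt u (dil ε⁻¹ q) * lap2 L φ q) (dil ε p) := by
        intro p
        simp only
        rw [lap2_comp_dil (hφ.of_le two_le_infty), dil_inv_dil hε.ne']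
        ring
      simp_rw [e]
      rw [integral_const_mul,
        integral_comp_dil (fun q => truncAt u (dil ε⁻¹ q) * lap2 L φ q) hε]
      simp_rw [mul_assoc]
      rw [integral_const_mul, ← mul_assoc]
      congr 1
      rw [zpow_neg, pow_add, show ε ^ (2 * n : ℤ) = ε ^ (2 * n) by norm_cast]
      field_simp
    have hlap := contDiff_lap2 (L := L) hφ
    have hlapc := hasCompactSupport_lap2 (L := L) hφc
    have hIu : Integrable fun p => u p * lap2 L φ p :=
      hloc.integrable_smul_right_of_hasCompactSupport hlap.continuous hlapc
    -- Since trunc s ≤ s for s ≥ 0, homogeneity bounds the rescaled truncation by u itself. At each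
    -- p ≠ 0 it equals u(p) as soon as ε^{2n} u(p) ≤ 1, so the pointwise limit is attained.
    have hlim1 : Tendsto (fun ε : ℝ => ∫ p, ε ^ (-(2 * n : ℤ)) * truncAt u (dil ε⁻¹ p) * lap2 L φ p)
        (𝓝[>] 0) (𝓝 (∫ p, u p * lap2 L φ p)) := by
      refine tendsto_integral_filter_of_dominated_convergence (fun p => ‖u p * lap2 L φ p‖)
        ?_ ?_ hIu.norm ?_
      · refine Eventually.of_forall fun ε => Continuous.aestronglyMeasurable ?_
        exact (continuous_const.mul (hv.continuous.comp
          (contDiff_dil (m := 0) _).continuous)).mul hlap.continuous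
      · filter_upwards [self_mem_nhdsWithin] with ε (hε : 0 < ε)
        filter_upwards [Measure.ae_ne volume (0 : Point n)] with p hp
        have hne := dil_ne_zero (inv_ne_zero hε.ne') hp
        have h1 := trunc_le (hpos _ hne).le
        have h2 := trunc_nonneg (hpos _ hne).le
        rw [norm_mul, norm_mul (u p), truncAt_of_ne hne]
        refine mul_le_mul_of_nonneg_right ?_ (norm_nonneg _)
        rw [Real.norm_of_nonneg (mul_nonneg (zpow_nonneg hε.le _) h2),
          Real.norm_of_nonneg (hpos p hp).le]
        refine (mul_le_mul_of_nonneg_left h1 (zpow_nonneg hε.le _)).trans_eq ?_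
        rw [hu _ (inv_pos.2 hε) p hp, ← mul_assoc, inv_zpow, mul_inv_cancel₀, one_mul]
        exact (zpow_pos hε _).ne'
      · filter_upwards [Measure.ae_ne volume (0 : Point n)] with p hp
        refine tendsto_const_nhds.congr' ?_
        have hsmall : ∀ᶠ ε : ℝ in 𝓝[>] 0, ε ^ (2 * n) * u p ≤ 1 := by
          have : Tendsto (fun ε : ℝ => ε ^ (2 * n) * u p) (𝓝 0) (𝓝 (0 ^ (2 * n) * u p)) :=
            Continuous.tendsto (by fun_prop) 0
          rw [zero_pow (by omega), zero_mul] at this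
          exact nhdsWithin_le_nhds (this.eventually_le_const zero_lt_one)
        filter_upwards [self_mem_nhdsWithin, hsmall] with ε (hε : 0 < ε) hεs
        have hne := dil_ne_zero (inv_ne_zero hε.ne') hp
        have hue : u (dil ε⁻¹ p) = ε ^ (2 * n) * u p := by
          rw [hu _ (inv_pos.2 hε) p hp, inv_zpow, zpow_neg, inv_inv]
          norm_cast
        rw [truncAt_of_ne hne, hue, trunc_of_le_one hεs, zpow_neg,
          show ε ^ (2 * n : ℤ) = ε ^ (2 * n) by norm_cast, ← mul_assoc,
          inv_mul_cancel₀ (by positivity), one_mul]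
    have hlim2 : Tendsto (fun ε : ℝ => ∫ p, lap2 L (truncAt u) p * φ (dil ε p))
        (𝓝[>] 0) (𝓝 (∫ p, lap2 L (truncAt u) p * φ 0)) := by
      obtain ⟨B, hB⟩ := hφ.continuous.bounded_above_of_compact_support hφc
      refine tendsto_integral_filter_of_dominated_convergence
        (fun p => ‖lap2 L (truncAt u) p‖ * B) ?_ ?_
        ((hg.continuous.integrable_of_hasCompactSupport hgc).norm.mul_const B) ?_
      · exact Eventually.of_forall fun ε => (hg.continuous.mul
          (hφ.continuous.comp (contDiff_dil (m := 0) _).continuous)).aestronglyMeasurable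
      · refine Eventually.of_forall fun ε => Eventually.of_forall fun p => ?_
        rw [norm_mul]
        exact mul_le_mul_of_nonneg_left (hB _) (norm_nonneg _)
      · refine Eventually.of_forall fun p => Tendsto.mono_left ?_ nhdsWithin_le_nhds
        refine Tendsto.const_mul _ ?_
        have hd : Continuous fun ε : ℝ => dil ε p := by unfold dil; fun_prop
        have := (hφ.continuous.comp hd).tendsto 0
        rwa [show (φ ∘ fun ε => dil ε p) 0 = φ 0 by simp [dil]; rfl] at this
    have heq := tendsto_nhds_unique (hlim1.congr' (by
      filter_upwards [self_mem_nhdsWithin] with ε hε using hgreen ε hε)) hlim2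
    rw [heq, integral_mul_const, hc, integral_neg]
    ring
  refine ⟨c⁻¹, inv_pos.2 hcpos, contDiffOn_const.mul hs, fun r hr p hp => ?_, ?_, ?_⟩
  · rw [hu r hr p hp, rpow_two_sub_homDim]; ring
  · exact hloc.smul c⁻¹
  · intro φ hφ hφc
    simp_rw [mul_assoc]
    rw [integral_const_mul, hweak φ hφ hφc]
    field_simp

end General

/-! ### Diagonal quadratic forms -/

section Quad

variable {n : ℕ} {L : Fin n → ℝ}

/-- The quadratic form `∑ i, c i x_i²`. -/
def quad {n : ℕ} (c : Fin n ⊕ Fin n → ℝ) (p : Point n) : ℝ := ∑ i, c i * p.1 i ^ 2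

theorem contDiff_quad (c : Fin n ⊕ Fin n → ℝ) {m : WithTop ℕ∞} : ContDiff ℝ m (quad c) := by
  unfold quad; fun_prop

theorem quad_nonneg {c : Fin n ⊕ Fin n → ℝ} (hc : ∀ i, 0 ≤ c i) (p : Point n) : 0 ≤ quad c p :=
  Finset.sum_nonneg fun i _ => mul_nonneg (hc i) (sq_nonneg _)

theorem quad_dil (c : Fin n ⊕ Fin n → ℝ) (r : ℝ) (p : Point n) :
    quad c (dil r p) = r ^ 2 * quad c p := by
  simp only [quad, dil, Finset.mul_sum, Pi.smul_apply, smul_eq_mul]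
  exact Finset.sum_congr rfl fun i _ => by ring

theorem X_coord (i k : Fin n ⊕ Fin n) (p : Point n) :
    X L i (fun q => q.1 k) p = if i = k then 1 else 0 := by
  have h : HasFDerivAt (fun q : Point n => q.1 k)
      ((ContinuousLinearMap.proj (R := ℝ) k).comp
        (ContinuousLinearMap.fst ℝ (Fin n ⊕ Fin n → ℝ) ℝ)) p :=
    ((ContinuousLinearMap.proj (R := ℝ) k).comp
        (ContinuousLinearMap.fst ℝ (Fin n ⊕ Fin n → ℝ) ℝ)).hasFDerivAt
  simp [X, h.fderiv, field, Pi.single_apply, eq_comm]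

theorem X_snd (i : Fin n ⊕ Fin n) (p : Point n) :
    X L i (fun q => q.2) p = (field L i p).2 := by
  have h : HasFDerivAt (fun q : Point n => q.2)
      (ContinuousLinearMap.snd ℝ (Fin n ⊕ Fin n → ℝ) ℝ) p := hasFDerivAt_snd
  simp [X, h.fderiv]

theorem X_quad (c : Fin n ⊕ Fin n → ℝ) (i : Fin n ⊕ Fin n) (p : Point n) :
    X L i (quad c) p = 2 * c i * p.1 i := by
  have h : ∀ k, X L i (fun q => c k * q.1 k ^ 2) p = if i = k then 2 * c i * p.1 i else 0 := by
    intro k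
    have hd : DifferentiableAt ℝ (fun q : Point n => q.1 k) p := by fun_prop
    rw [X_const_mul (by fun_prop), X_comp (φ := fun s => s ^ 2) (hasDerivAt_pow 2 _) hd, X_coord]
    split_ifs with hik
    · subst hik; simp; ring
    · simp
  have := X_sum (L := L) (s := Finset.univ) (f := fun k q => c k * q.1 k ^ 2) (p := p)
    (fun k _ => by fun_prop) i
  simp only [h, Finset.sum_ite_eq, Finset.mem_univ, if_true] at this
  exact this

theorem lap2_quad (c : Fin n ⊕ Fin n → ℝ) (p : Point n) :
    lap2 L (quad c) p = ∑ i, 2 * c i := by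
  refine Finset.sum_congr rfl fun i _ => ?_
  have h : X L i (quad c) = fun q => 2 * c i * q.1 i := funext fun q => X_quad c i q
  rw [h, X_const_mul (by fun_prop), X_coord, if_pos rfl, mul_one]

theorem gam_quad_quad (c d : Fin n ⊕ Fin n → ℝ) (p : Point n) :
    gam L (quad c) (quad d) p = ∑ i, 4 * c i * d i * p.1 i ^ 2 :=
  Finset.sum_congr rfl fun i _ => by rw [X_quad, X_quad]; ring

theorem lap2_snd (p : Point n) : lap2 L (fun q => q.2) p = 0 := by
  refine Finset.sum_eq_zero fun i _ => ?_
  rcases i with j | j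
  · have h : X L (Sum.inl j) (fun q : Point n => q.2) = fun q => (-L j) * q.1 (Sum.inr j) :=
      funext fun q => by rw [X_snd]; simp [field]
    rw [h, X_const_mul (by fun_prop), X_coord]; simp
  · have h : X L (Sum.inr j) (fun q : Point n => q.2) = fun q => L j * q.1 (Sum.inl j) :=
      funext fun q => by rw [X_snd]; rfl
    rw [h, X_const_mul (by fun_prop), X_coord]; simp

end Quad

/-! ### The explicit gauge -/

section Explicit

/-- The difference of the two forms `A` and `B`. -/
noncomputable def formD (l : ℝ) : Point 2 → ℝ :=
  quad (Sum.elim ![|l| / 2, 0] ![|l| / 2, 0])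

theorem formA_sub_formB (l : ℝ) (p : Point 2) : formA l p - formB l p = formD l p := by
  simp [formA, formB, formD, quad]; ring

theorem formB_eq_quad (l : ℝ) :
    formB l = quad (Sum.elim ![|l| / 2, |l|] ![|l| / 2, |l|]) := by
  ext p
  simp [formB, quad]; ring

/-- The radius `√(B² + t²)`. -/
noncomputable def rad (l : ℝ) (p : Point 2) : ℝ := √(formB l p ^ 2 + p.2 ^ 2)

variable {l : ℝ}

theorem contDiff_formB {m : WithTop ℕ∞} : ContDiff ℝ m (formB l) := by
  rw [formB_eq_quad]; exact contDiff_quad _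

theorem contDiff_formD {m : WithTop ℕ∞} : ContDiff ℝ m (formD l) := contDiff_quad _

theorem formB_nonneg (p : Point 2) : 0 ≤ formB l p := by unfold formB; positivity

theorem formD_nonneg (p : Point 2) : 0 ≤ formD l p := by
  refine quad_nonneg (fun i => ?_) p
  rcases i with i | i <;> fin_cases i <;> simp <;> positivity

theorem formD_le_formB (p : Point 2) : formD l p ≤ formB l p := by
  rw [← formA_sub_formB, formA, formB]
  nlinarith [mul_nonneg (abs_nonneg l) (sq_nonneg (p.1 (Sum.inl 1))),
    mul_nonneg (abs_nonneg l) (sq_nonneg (p.1 (Sum.inr 1)))]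

theorem rad_sq (p : Point 2) : rad l p * rad l p = formB l p * formB l p + p.2 * p.2 := by
  rw [rad, Real.mul_self_sqrt (by positivity)]; ring

theorem rad_nonneg (p : Point 2) : 0 ≤ rad l p := Real.sqrt_nonneg _

theorem formB_le_rad (p : Point 2) : formB l p ≤ rad l p :=
  Real.le_sqrt_of_sq_le (by nlinarith [sq_nonneg p.2])

theorem abs_snd_le_rad (p : Point 2) : |p.2| ≤ rad l p :=
  Real.abs_le_sqrt (by nlinarith [sq_nonneg (formB l p)])

theorem rad_pos (hl : l ≠ 0) {p : Point 2} (hp : p ≠ 0) : 0 < rad l p := by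
  refine lt_of_le_of_ne (rad_nonneg p) fun h => hp ?_
  have h1 : formB l p = 0 := le_antisymm (h ▸ formB_le_rad p) (formB_nonneg p)
  have h2 : p.2 = 0 := abs_nonpos_iff.1 (h ▸ abs_snd_le_rad p)
  have hl' := abs_pos.2 hl
  have h3 : 1 / 2 * p.1 (Sum.inl 0) ^ 2 + p.1 (Sum.inl 1) ^ 2
    + 1 / 2 * p.1 (Sum.inr 0) ^ 2 + p.1 (Sum.inr 1) ^ 2 = 0 := by
    simpa [formB, hl] using h1
  refine Prod.ext (funext fun i => pow_eq_zero_iff (n := 2) two_ne_zero |>.1 ?_) h2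
  have s1 := sq_nonneg (p.1 (Sum.inl 0))
  have s2 := sq_nonneg (p.1 (Sum.inl 1))
  have s3 := sq_nonneg (p.1 (Sum.inr 0))
  have s4 := sq_nonneg (p.1 (Sum.inr 1))
  rcases i with i | i <;> fin_cases i <;> simp <;> nlinarith

theorem formD_add_rad_pos (hl : l ≠ 0) {p : Point 2} (hp : p ≠ 0) : 0 < formD l p + rad l p :=
  add_pos_of_nonneg_of_pos (formD_nonneg p) (rad_pos hl hp)

theorem formB_add_rad_pos (hl : l ≠ 0) {p : Point 2} (hp : p ≠ 0) : 0 < formB l p + rad l p :=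
  add_pos_of_nonneg_of_pos (formB_nonneg p) (rad_pos hl hp)

theorem contDiffAt_rad (hl : l ≠ 0) {p : Point 2} (hp : p ≠ 0) {m : WithTop ℕ∞} :
    ContDiffAt ℝ m (rad l) p := by
  have h : ContDiff ℝ m fun q : Point 2 => formB l q ^ 2 + q.2 ^ 2 :=
    (contDiff_formB.pow 2).add (contDiff_snd.pow 2)
  refine h.contDiffAt.sqrt fun h0 => (rad_pos hl hp).ne' ?_
  rw [rad, h0, Real.sqrt_zero]

/-- The logarithm of `N`. -/
noncomputable def logN (l : ℝ) (p : Point 2) : ℝ :=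
  1 / 4 * Real.log (rad l p) + (3 / 8 * Real.log (formD l p + rad l p)
    + (-1 / 8) * Real.log (formB l p + rad l p))

theorem normN_eq_exp (hl : l ≠ 0) {p : Point 2} (hp : p ≠ 0) :
    normN l p = Real.exp (logN l p) := by
  have hr := rad_pos hl hp
  have hq := formD_add_rad_pos hl hp
  have hb := formB_add_rad_pos hl hp
  have h1 : formB l p ^ 2 + p.2 ^ 2 = rad l p ^ 2 := by
    rw [sq (rad l p), rad_sq]; ring
  rw [normN, formA_sub_formB, ← rad, h1, Real.rpow_def_of_pos hq, Real.rpow_def_of_pos hb,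
    Real.rpow_def_of_pos (by positivity), ← Real.exp_add, ← Real.exp_sub, logN, Real.log_pow]
  congr 1
  push_cast
  ring

theorem normN_pos (hl : l ≠ 0) {p : Point 2} (hp : p ≠ 0) : 0 < normN l p := by
  rw [normN_eq_exp hl hp]; exact Real.exp_pos _

theorem normN_zpow_eq_exp (hl : l ≠ 0) {p : Point 2} (hp : p ≠ 0) :
    normN l p ^ (-4 : ℤ) = Real.exp (-4 * logN l p) := by
  rw [normN_eq_exp hl hp, show (-4 : ℤ) = -((4 : ℕ) : ℤ) by norm_num, zpow_neg, zpow_natCast,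
    ← Real.exp_nat_mul, ← Real.exp_neg]
  congr 1
  push_cast
  ring

theorem contDiffAt_logN (hl : l ≠ 0) {p : Point 2} (hp : p ≠ 0) {m : WithTop ℕ∞} :
    ContDiffAt ℝ m (logN l) p := by
  have hr : ContDiffAt ℝ m (rad l) p := contDiffAt_rad hl hp
  exact (contDiffAt_const.mul (hr.log (rad_pos hl hp).ne')).add
    ((contDiffAt_const.mul ((contDiff_formD.contDiffAt.add hr).log
      (formD_add_rad_pos hl hp).ne')).add
    (contDiffAt_const.mul ((contDiff_formB.contDiffAt.add hr).log
      (formB_add_rad_pos hl hp).ne')))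

theorem formB_dil (r : ℝ) (p : Point 2) : formB l (dil r p) = r ^ 2 * formB l p := by
  rw [formB_eq_quad, quad_dil]

theorem formD_dil (r : ℝ) (p : Point 2) : formD l (dil r p) = r ^ 2 * formD l p := quad_dil _ _ _

theorem rad_dil (r : ℝ) (p : Point 2) : rad l (dil r p) = r ^ 2 * rad l p := by
  rw [rad, formB_dil, rad]
  rw [show (r ^ 2 * formB l p) ^ 2 + (dil r p).2 ^ 2 =
    (r ^ 2) ^ 2 * (formB l p ^ 2 + p.2 ^ 2) by simp [dil]; ring,
    Real.sqrt_mul (by positivity), Real.sqrt_sq (by positivity)]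

theorem normN_dil (hl : l ≠ 0) {r : ℝ} (hr : 0 < r) {p : Point 2} (hp : p ≠ 0) :
    normN l (dil r p) = r * normN l p := by
  have h1 := (rad_pos hl hp).ne'
  have h2 := (formD_add_rad_pos hl hp).ne'
  have h3 := (formB_add_rad_pos hl hp).ne'
  have hr2 : r ^ 2 ≠ 0 := by positivity
  rw [normN_eq_exp hl hp, normN_eq_exp hl (dil_ne_zero hr.ne' hp), logN, logN, formB_dil,
    formD_dil, rad_dil, ← mul_add, ← mul_add, Real.log_mul hr2 h1, Real.log_mul hr2 h2,
    Real.log_mul hr2 h3, Real.log_pow]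
  nth_rewrite 4 [← Real.exp_log hr]
  rw [← Real.exp_add]
  congr 1
  push_cast
  ring

theorem isHomog_normN_zpow (hl : l ≠ 0) : IsHomog (fun p => normN l p ^ (-4 : ℤ)) (-4) :=
  fun r hr p hp => by simp only [normN_dil hl hr hp, mul_zpow]

theorem contDiffOn_normN_zpow (hl : l ≠ 0) :
    ContDiffOn ℝ ∞ (fun p => normN l p ^ (-4 : ℤ)) {0}ᶜ := by
  intro p hp
  refine ContDiffAt.contDiffWithinAt ?_
  have h : ContDiffAt ℝ ∞ (fun q => Real.exp (-4 * logN l q)) p :=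
    (contDiffAt_const.mul (contDiffAt_logN hl hp)).exp
  refine h.congr_of_eventuallyEq ?_
  filter_upwards [isOpen_compl_singleton.mem_nhds hp] with q hq using normN_zpow_eq_exp hl hq

/-! ### Horizontal calculus of the gauge -/

variable {L : Fin 2 → ℝ}

theorem gam_formB_formB (p : Point 2) :
    gam L (formB (L 0)) (formB (L 0)) p =
      |L 0| * (4 * formB (L 0) p - 2 * formD (L 0) p) := by
  rw [formB_eq_quad, gam_quad_quad, formD]
  simp [quad]; ring

theorem gam_formB_formD (p : Point 2) :
    gam L (formB (L 0)) (formD (L 0)) p = 2 * |L 0| * formD (L 0) p := by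
  rw [formB_eq_quad, formD, gam_quad_quad]
  simp [quad]; ring

theorem gam_formD_formD (p : Point 2) :
    gam L (formD (L 0)) (formD (L 0)) p = 2 * |L 0| * formD (L 0) p := by
  rw [formD, gam_quad_quad]
  simp [quad]; ring

theorem gam_formB_snd (p : Point 2) : gam L (formB (L 0)) (fun q => q.2) p = 0 := by
  rw [formB_eq_quad]
  simp [gam, X_quad, X_snd, field]; ring

theorem gam_formD_snd (p : Point 2) : gam L (formD (L 0)) (fun q => q.2) p = 0 := by
  simp [gam, formD, X_quad, X_snd, field]; ring

/-- Γ(t,t) = Σ L_j²(x_j² + x_{j+2}²), and with L₂ = 2L₁ this is the same quadratic form as Γ(B,B).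
All later uses of the ratio of the L_j go through this identity. -/
theorem gam_snd_snd (hL : L 1 = 2 * L 0) (p : Point 2) :
    gam L (fun q => q.2) (fun q => q.2) p =
      |L 0| * (4 * formB (L 0) p - 2 * formD (L 0) p) := by
  have h : |L 0| * |L 0| = L 0 * L 0 := abs_mul_abs_self _
  simp [gam, X_snd, field, formB, formD, quad, hL]
  linear_combination (-(p.1 (Sum.inl 0)) ^ 2 - 4 * (p.1 (Sum.inl 1)) ^ 2 - (p.1 (Sum.inr 0)) ^ 2
    - 4 * (p.1 (Sum.inr 1)) ^ 2) * h

theorem lap2_formB (p : Point 2) : lap2 L (formB (L 0)) p = 6 * |L 0| := by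
  rw [formB_eq_quad, lap2_quad]
  simp; ring

theorem lap2_formD (p : Point 2) : lap2 L (formD (L 0)) p = 2 * |L 0| := by
  rw [formD, lap2_quad]
  simp; ring

/-- Leibniz applied to R² = B² + t², which avoids differentiating the square root. -/
theorem rad_mul_gam (hl : L 0 ≠ 0) (f : Point 2 → ℝ) {p : Point 2} (hp : p ≠ 0) :
    rad (L 0) p * gam L f (rad (L 0)) p =
      formB (L 0) p * gam L f (formB (L 0)) p + p.2 * gam L f (fun q => q.2) p := by
  have hr : DifferentiableAt ℝ (rad (L 0)) p :=
    (contDiffAt_rad hl hp (m := 1)).differentiableAt (by simp)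
  have hB : DifferentiableAt ℝ (formB (L 0)) p :=
    (contDiff_formB (m := 1)).differentiable (by simp) p
  have ht : DifferentiableAt ℝ (fun q : Point 2 => q.2) p := by fun_prop
  have h : gam L f (fun q => rad (L 0) q * rad (L 0) q) p =
      gam L f (fun q => formB (L 0) q * formB (L 0) q + q.2 * q.2) p := by
    simp only [rad_sq]
  rw [gam_mul_right hr hr, gam_add_right (hB.fun_mul hB) (ht.fun_mul ht), gam_mul_right hB hB,
    gam_mul_right ht ht] at h
  linarith

theorem gam_formB_rad (hl : L 0 ≠ 0) {p : Point 2} (hp : p ≠ 0) :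
    gam L (formB (L 0)) (rad (L 0)) p =
    |L 0| * (4 * formB (L 0) p - 2 * formD (L 0) p) * formB (L 0) p / rad (L 0) p := by
  have h := rad_mul_gam hl (formB (L 0)) hp
  rw [gam_formB_formB, gam_formB_snd] at h
  rw [eq_div_iff (rad_pos hl hp).ne']
  linarith

theorem gam_formD_rad (hl : L 0 ≠ 0) {p : Point 2} (hp : p ≠ 0) :
    gam L (formD (L 0)) (rad (L 0)) p =
    2 * |L 0| * formD (L 0) p * formB (L 0) p / rad (L 0) p := by
  have h := rad_mul_gam hl (formD (L 0)) hp
  rw [gam_formD_snd, gam_comm, gam_comm (formD _) (formB _), gam_formB_formD, gam_comm] at h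
  rw [eq_div_iff (rad_pos hl hp).ne']
  linarith

/-- R²Γ(R,R) = B²Γ(B,B) + t²Γ(t,t), the cross term being zero; as the two Γ agree, the factor B² +
t² = R² cancels. -/
theorem gam_rad_rad (hl : L 0 ≠ 0) (hL : L 1 = 2 * L 0) {p : Point 2} (hp : p ≠ 0) :
    gam L (rad (L 0)) (rad (L 0)) p =
    |L 0| * (4 * formB (L 0) p - 2 * formD (L 0) p) := by
  have hr := (rad_pos hl hp).ne'
  have h := rad_mul_gam hl (rad (L 0)) hp
  have h2 := rad_mul_gam hl (fun q => q.2) hp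
  rw [gam_comm _ (formB _), gam_comm _ (fun q : Point 2 => q.2), gam_formB_rad hl hp] at h
  rw [gam_comm _ (formB _), gam_formB_snd, gam_snd_snd hL] at h2
  have h3 := rad_sq (l := L 0) p
  refine mul_left_cancel₀ (mul_ne_zero hr hr) ?_
  have h4 : rad (L 0) p * (formB (L 0) p * (|L 0| * (4 * formB (L 0) p - 2 * formD (L 0) p) *
      formB (L 0) p / rad (L 0) p)) =
      formB (L 0) p * formB (L 0) p * (|L 0| * (4 * formB (L 0) p - 2 * formD (L 0) p)) := by
    field_simp
  linear_combination rad (L 0) p * h + h4 + p.2 * h2 -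
    (|L 0| * (4 * formB (L 0) p - 2 * formD (L 0) p)) * h3

theorem lap2_rad (hl : L 0 ≠ 0) (hL : L 1 = 2 * L 0) {p : Point 2} (hp : p ≠ 0) :
    lap2 L (rad (L 0)) p =
    |L 0| * (10 * formB (L 0) p - 2 * formD (L 0) p) / rad (L 0) p := by
  have hr : ContDiffAt ℝ 2 (rad (L 0)) p := contDiffAt_rad hl hp
  have hB : ContDiffAt ℝ 2 (formB (L 0)) p := contDiff_formB.contDiffAt
  have ht : ContDiffAt ℝ 2 (fun q : Point 2 => q.2) p := contDiff_snd.contDiffAt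
  have h : lap2 L (fun q => rad (L 0) q * rad (L 0) q) p =
      lap2 L (fun q => formB (L 0) q * formB (L 0) q + q.2 * q.2) p := by
    simp only [rad_sq]
  rw [lap2_mul hr hr, lap2_add (hB.mul hB) (ht.mul ht), lap2_mul hB hB, lap2_mul ht ht,
    lap2_formB, lap2_snd, gam_formB_formB, gam_snd_snd hL, gam_rad_rad hl hL hp] at h
  rw [eq_div_iff (rad_pos hl hp).ne']
  linarith

theorem gam_logN (hl : L 0 ≠ 0) {p : Point 2} (hp : p ≠ 0)
    (f : Point 2 → ℝ) : gam L f (logN (L 0)) p =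
    1 / 4 * ((rad (L 0) p)⁻¹ * gam L f (rad (L 0)) p) +
    (3 / 8 * ((formD (L 0) p + rad (L 0) p)⁻¹ *
      (gam L f (formD (L 0)) p + gam L f (rad (L 0)) p)) +
    (-1 / 8) * ((formB (L 0) p + rad (L 0) p)⁻¹ *
      (gam L f (formB (L 0)) p + gam L f (rad (L 0)) p))) := by
  have hr : DifferentiableAt ℝ (rad (L 0)) p :=
    (contDiffAt_rad hl hp (m := 1)).differentiableAt (by simp)
  have hB : DifferentiableAt ℝ (formB (L 0)) p :=
    (contDiff_formB (m := 1)).differentiable (by simp) p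
  have hD : DifferentiableAt ℝ (formD (L 0)) p :=
    (contDiff_formD (m := 1)).differentiable (by simp) p
  have r0 := (rad_pos hl hp).ne'
  have q0 := (formD_add_rad_pos hl hp).ne'
  have p0 := (formB_add_rad_pos hl hp).ne'
  have hDr := hD.fun_add hr
  have hBr := hB.fun_add hr
  unfold logN
  rw [gam_add_right ((hr.log r0).const_mul _)
      (((hDr.log q0).const_mul _).fun_add ((hBr.log p0).const_mul _)),
    gam_add_right ((hDr.log q0).const_mul _) ((hBr.log p0).const_mul _),
    gam_const_mul_right (hr.log r0), gam_const_mul_right (hDr.log q0),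
    gam_const_mul_right (hBr.log p0), gam_comp_right (Real.hasDerivAt_log r0) hr,
    gam_comp_right (Real.hasDerivAt_log q0) hDr, gam_comp_right (Real.hasDerivAt_log p0) hBr,
    gam_add_right hD hr, gam_add_right hB hr]

theorem gam_logN_logN (hl : L 0 ≠ 0) (hL : L 1 = 2 * L 0) {p : Point 2} (hp : p ≠ 0) :
    gam L (logN (L 0)) (logN (L 0)) p = |L 0| *
    ((2 * formB (L 0) p - formD (L 0) p) * rad (L 0) p * (formD (L 0) p + rad (L 0) p) +
      3 * formB (L 0) p * rad (L 0) p * (formB (L 0) p + rad (L 0) p) +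
      6 * (formD (L 0) p * formB (L 0) p + 2 * formB (L 0) p * rad (L 0) p -
        formD (L 0) p * rad (L 0) p) * (formB (L 0) p + rad (L 0) p)) /
    (16 * rad (L 0) p ^ 2 * (formB (L 0) p + rad (L 0) p) * (formD (L 0) p + rad (L 0) p)) := by
  have r0 := (rad_pos hl hp).ne'
  have q0 := (formD_add_rad_pos hl hp).ne'
  have p0 := (formB_add_rad_pos hl hp).ne'
  rw [gam_logN hl hp, gam_comm _ (rad _), gam_comm _ (formD _), gam_comm _ (formB _),
    gam_logN hl hp (rad _), gam_logN hl hp (formD _), gam_logN hl hp (formB _),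
    gam_comm (rad _) (formD _), gam_comm (rad _) (formB _), gam_comm (formD _) (formB _),
    gam_rad_rad hl hL hp, gam_formB_rad hl hp, gam_formD_rad hl hp, gam_formB_formB,
    gam_formD_formD, gam_formB_formD]
  generalize rad (L 0) p = r at *
  generalize formB (L 0) p = b at *
  generalize formD (L 0) p = d at *
  field_simp
  ring

/-- All terms reduce to B, D, R with t eliminated, so the claim is an identity of rational functions
in three free variables. The factor 4 is Q − 2, as required for exp(−4 log N) to be harmonic. -/
theorem lap2_logN (hl : L 0 ≠ 0) (hL : L 1 = 2 * L 0) {p : Point 2} (hp : p ≠ 0) :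
    lap2 L (logN (L 0)) p = 4 * gam L (logN (L 0)) (logN (L 0)) p := by
  rw [gam_logN_logN hl hL hp]
  have hr : ContDiffAt ℝ 2 (rad (L 0)) p := contDiffAt_rad hl hp
  have hB : ContDiffAt ℝ 2 (formB (L 0)) p := contDiff_formB.contDiffAt
  have hD : ContDiffAt ℝ 2 (formD (L 0)) p := contDiff_formD.contDiffAt
  have r0 := (rad_pos hl hp).ne'
  have q0 := (formD_add_rad_pos hl hp).ne'
  have p0 := (formB_add_rad_pos hl hp).ne'
  have hDr : ContDiffAt ℝ 2 (fun q => formD (L 0) q + rad (L 0) q) p := hD.add hr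
  have hBr : ContDiffAt ℝ 2 (fun q => formB (L 0) q + rad (L 0) q) p := hB.add hr
  have hlog : ∀ {f : Point 2 → ℝ}, ContDiffAt ℝ 2 f p → f p ≠ 0 →
      lap2 L (fun q => Real.log (f q)) p = (f p)⁻¹ * lap2 L f p + (-(f p ^ 2)⁻¹) * gam L f f p :=
    fun {f} hf h0 => lap2_comp (φ := Real.log) (φ' := fun s => s⁻¹)
      ((eventually_ne_nhds h0).mono fun s hs => Real.hasDerivAt_log hs) (hasDerivAt_inv h0) hf
  have hgam : ∀ {f : Point 2 → ℝ}, ContDiffAt ℝ 2 f p →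
      gam L (fun q => f q + rad (L 0) q) (fun q => f q + rad (L 0) q) p =
        gam L f f p + 2 * gam L f (rad (L 0)) p + gam L (rad (L 0)) (rad (L 0)) p := by
    intro f hf
    have h1 := hf.differentiableAt (by simp)
    have h2 := hr.differentiableAt (by simp)
    rw [gam_add_right h1 h2, gam_comm _ f, gam_comm _ (rad _), gam_add_right h1 h2,
      gam_add_right h1 h2, gam_comm (rad _) f]
    ring
  unfold logN
  rw [lap2_add (contDiffAt_const.mul (hr.log r0))
      ((contDiffAt_const.mul (hDr.log q0)).add (contDiffAt_const.mul (hBr.log p0))),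
    lap2_add (contDiffAt_const.mul (hDr.log q0)) (contDiffAt_const.mul (hBr.log p0)),
    lap2_const_mul (hr.log r0), lap2_const_mul (hDr.log q0), lap2_const_mul (hBr.log p0),
    hlog hr r0, hlog hDr q0, hlog hBr p0, lap2_add hD hr, lap2_add hB hr, hgam hD, hgam hB,
    gam_rad_rad hl hL hp, gam_formB_rad hl hp, gam_formD_rad hl hp, gam_formB_formB,
    gam_formD_formD, lap2_rad hl hL hp, lap2_formB, lap2_formD]
  generalize rad (L 0) p = r at *
  generalize formB (L 0) p = b at *
  generalize formD (L 0) p = d at *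
  field_simp
  ring

theorem lap2_normN_zpow (hl : L 0 ≠ 0) (hL : L 1 = 2 * L 0) {p : Point 2} (hp : p ≠ 0) :
    lap2 L (fun q => normN (L 0) q ^ (-4 : ℤ)) p = 0 := by
  have h : (fun q => normN (L 0) q ^ (-4 : ℤ)) =ᶠ[𝓝 p] fun q => Real.exp (-4 * logN (L 0) q) := by
    filter_upwards [isOpen_compl_singleton.mem_nhds hp] with q hq using normN_zpow_eq_exp hl hq
  have hφ : ∀ s : ℝ, HasDerivAt (fun s => Real.exp (-4 * s)) (-4 * Real.exp (-4 * s)) s := by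
    intro s
    have := ((hasDerivAt_id s).const_mul (-4)).exp
    simpa [mul_comm] using this
  rw [lap2_congr h, lap2_comp (φ := fun s => Real.exp (-4 * s)) (Eventually.of_forall hφ)
    ((hφ _).const_mul (-4)) (contDiffAt_logN hl hp), lap2_logN hl hL hp]
  ring


end Explicit

/-! ### Size of the gauge and local integrability -/

theorem integrableOn_abs_rpow {s : ℝ} (hs : -1 < s) (M : ℝ) :
    IntegrableOn (fun x : ℝ => |x| ^ s) (Set.Icc (-M) M) := by
  rcases le_or_gt 0 M with hM | hM
  · have h1 : IntervalIntegrable (fun x : ℝ => |x| ^ s) volume 0 M := by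
      refine (intervalIntegral.intervalIntegrable_rpow' hs).congr fun x hx => ?_
      rw [Set.uIoc_of_le hM] at hx
      simp only [abs_of_pos hx.1]
    have h2 : IntervalIntegrable (fun x : ℝ => |x| ^ s) volume (-M) 0 := by
      have := (IntervalIntegrable.iff_comp_neg (f := fun x : ℝ => |x| ^ s)).1 h1
      simpa using this.symm
    exact (intervalIntegrable_iff_integrableOn_Icc_of_le (by linarith)).1 (h2.trans h1)
  · rw [Set.Icc_eq_empty (by linarith)]; exact integrableOn_empty

/-- On a box the integrand is a product of one-variable powers, each integrable because its exponent
exceeds −1. -/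
theorem locallyIntegrable_prod_abs_rpow {n : ℕ} {s s' : ℝ} (hs : -1 < s) (hs' : -1 < s') :
    LocallyIntegrable fun p : Point n => (∏ i, |p.1 i| ^ s) * |p.2| ^ s' := by
  refine locallyIntegrable_iff.2 fun K hK => ?_
  obtain ⟨M, hM⟩ := hK.isBounded.subset_closedBall (0 : Point n)
  have hsub : K ⊆ (Set.univ.pi fun _ => Set.Icc (-M) M) ×ˢ Set.Icc (-M) M := by
    intro p hp
    have h1 := mem_closedBall_zero_iff.1 (hM hp)
    refine ⟨fun i _ => abs_le.1 ?_, abs_le.1 ((norm_snd_le p).trans h1)⟩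
    exact (norm_le_pi_norm p.1 i).trans ((norm_fst_le p).trans h1)
  refine IntegrableOn.mono_set ?_ hsub
  have h1 : Integrable (fun x : Fin n ⊕ Fin n → ℝ => ∏ i, |x i| ^ s)
      (Measure.pi fun _ => volume.restrict (Set.Icc (-M) M)) :=
    Integrable.fintype_prod (f := fun _ (x : ℝ) => |x| ^ s) fun _ => integrableOn_abs_rpow hs M
  rw [← Measure.restrict_pi_pi] at h1
  have h2 := h1.mul_prod (integrableOn_abs_rpow hs' M)
  rw [Measure.prod_restrict] at h2
  exact h2

section Bounds

variable {l : ℝ}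

/-- Since B ≤ R, D + R ≥ D + B = A, and A dominates each |l| x_i². -/
theorem sq_coord_le (p : Point 2) (i : Fin 2 ⊕ Fin 2) :
    |l| * p.1 i ^ 2 ≤ formD l p + rad l p := by
  have h1 := formB_le_rad (l := l) p
  have h2 := formA_sub_formB l p
  have h3 : formA l p ≤ formD l p + rad l p := by linarith
  refine le_trans ?_ h3
  rw [formA]
  refine mul_le_mul_of_nonneg_left ?_ (abs_nonneg l)
  have s1 := sq_nonneg (p.1 (Sum.inl 0))
  have s2 := sq_nonneg (p.1 (Sum.inl 1))
  have s3 := sq_nonneg (p.1 (Sum.inr 0))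
  have s4 := sq_nonneg (p.1 (Sum.inr 1))
  rcases i with i | i <;> fin_cases i <;> simp <;> linarith

theorem continuous_formD_add_rad : Continuous fun p : Point 2 => formD l p + rad l p := by
  have h1 := (contDiff_formD (l := l) (m := 0)).continuous
  have h2 := (contDiff_formB (l := l) (m := 0)).continuous
  unfold rad
  fun_prop

/-- N^{-4} = R^{-1}(D+R)^{-3/2}(B+R)^{1/2}; use R ≤ B + R and R ≤ D + R. This gives the blow-up at
the origin. -/
theorem inv_sq_le_normN_zpow (hl : l ≠ 0) {p : Point 2} (hp : p ≠ 0) :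
    ((formD l p + rad l p) ^ 2)⁻¹ ≤ normN l p ^ (-4 : ℤ) := by
  have r0 := rad_pos hl hp
  have q0 := formD_add_rad_pos hl hp
  have b0 := formB_nonneg (l := l) p
  have d0 := formD_nonneg (l := l) p
  rw [normN_zpow_eq_exp hl hp, ← Real.exp_log (inv_pos.2 (pow_pos q0 2)), Real.exp_le_exp,
    Real.log_inv, Real.log_pow, logN]
  have h1 := Real.log_le_log r0 (by linarith : rad l p ≤ formB l p + rad l p)
  have h2 := Real.log_le_log r0 (by linarith : rad l p ≤ formD l p + rad l p)
  push_cast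
  linarith

/-- D ≤ B ≤ R makes B + R and D + R at most 2R; each replacement costs √2. This gives the decay at
infinity. -/
theorem normN_zpow_le_two_mul (hl : l ≠ 0) {p : Point 2} (hp : p ≠ 0) :
    normN l p ^ (-4 : ℤ) ≤ 2 * ((formD l p + rad l p) ^ 2)⁻¹ := by
  have r0 := rad_pos hl hp
  have q0 := formD_add_rad_pos hl hp
  have p0 := formB_add_rad_pos hl hp
  have h3 := formB_le_rad (l := l) p
  have h4 := formD_le_formB (l := l) p
  rw [normN_zpow_eq_exp hl hp,
    ← Real.exp_log (by positivity : 0 < 2 * ((formD l p + rad l p) ^ 2)⁻¹), Real.exp_le_exp,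
    Real.log_mul two_ne_zero (by positivity), Real.log_inv, Real.log_pow, logN]
  have h1 := Real.log_le_log p0 (by linarith : formB l p + rad l p ≤ 2 * rad l p)
  have h2 := Real.log_le_log q0 (by linarith : formD l p + rad l p ≤ 2 * rad l p)
  rw [Real.log_mul two_ne_zero r0.ne'] at h1 h2
  push_cast
  linarith

/-- N^{-4} ≤ √2 R^{-1/2}(D+R)^{-3/2}. Bound R below by |t|, and split the second power into four
factors (D+R)^{-3/8}, one for each |l| x_i² ≤ D + R. The resulting exponents −3/4 and −1/2 both
exceed −1, which gives local integrability. -/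
theorem normN_zpow_le_prod (hl : l ≠ 0) {p : Point 2} (hx : ∀ i, p.1 i ≠ 0) (ht : p.2 ≠ 0) :
    normN l p ^ (-4 : ℤ) ≤ Real.exp (1 / 2 * Real.log 2 - 3 / 2 * Real.log |l|) *
      ((∏ i, |p.1 i| ^ (-(3 / 4) : ℝ)) * |p.2| ^ (-(1 / 2) : ℝ)) := by
  have hp : p ≠ 0 := fun h => ht (by simp [h])
  have r0 := rad_pos hl hp
  have p0 := formB_add_rad_pos hl hp
  have h3 := formB_le_rad (l := l) p
  have h1 := Real.log_le_log p0 (by linarith : formB l p + rad l p ≤ 2 * rad l p)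
  rw [Real.log_mul two_ne_zero r0.ne'] at h1
  have h2 := Real.log_le_log (abs_pos.2 ht) (abs_snd_le_rad (l := l) p)
  have h4 : ∀ i, Real.log |l| + 2 * Real.log |p.1 i| ≤ Real.log (formD l p + rad l p) := by
    intro i
    have hi := abs_pos.2 (hx i)
    have hle : |l| * |p.1 i| ^ 2 ≤ formD l p + rad l p := by
      rw [sq_abs]; exact sq_coord_le p i
    have := Real.log_le_log (mul_pos (abs_pos.2 hl) (pow_pos hi 2)) hle
    rwa [Real.log_mul (abs_pos.2 hl).ne' (pow_pos hi 2).ne', Real.log_pow] at this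
  have h5 : ∀ i, |p.1 i| ^ (-(3 / 4) : ℝ) = Real.exp (-(3 / 4) * Real.log |p.1 i|) := fun i => by
    rw [Real.rpow_def_of_pos (abs_pos.2 (hx i)), mul_comm]
  simp_rw [h5]
  rw [normN_zpow_eq_exp hl hp, ← Real.exp_sum, Real.rpow_def_of_pos (abs_pos.2 ht),
    ← Real.exp_add, ← Real.exp_add, Real.exp_le_exp, logN]
  simp only [Fintype.sum_sum_type, Fin.sum_univ_two]
  have a1 := h4 (Sum.inl 0)
  have a2 := h4 (Sum.inl 1)
  have a3 := h4 (Sum.inr 0)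
  have a4 := h4 (Sum.inr 1)
  linarith

theorem locallyIntegrable_normN_zpow (hl : l ≠ 0) :
    LocallyIntegrable fun p : Point 2 => normN l p ^ (-4 : ℤ) := by
  have h := (locallyIntegrable_prod_abs_rpow (n := 2) (s := -(3 / 4)) (s' := -(1 / 2))
    (by norm_num) (by norm_num)).smul (Real.exp (1 / 2 * Real.log 2 - 3 / 2 * Real.log |l|))
  have hmeas : AEStronglyMeasurable fun p : Point 2 => normN l p ^ (-4 : ℤ) := by
    have hc : Continuous (formB l) := (contDiff_formB (m := 0)).continuous
    have hm : Measurable (normN l) := by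
      have h1 := hc.measurable
      have h2 : Measurable (formA l) := by
        unfold formA; fun_prop
      unfold normN
      fun_prop
    exact (hm.pow_const (-4 : ℤ)).aestronglyMeasurable
  refine h.mono hmeas ?_
  have hx : ∀ᵐ p : Point 2, ∀ i, p.1 i ≠ 0 := by
    rw [ae_all_iff]
    intro i
    have h1 : ∀ᵐ x : Fin 2 ⊕ Fin 2 → ℝ, x i ≠ 0 :=
      (Measure.quasiMeasurePreserving_eval (μ := fun _ => volume) i).ae (Measure.ae_ne volume 0)
    exact Measure.quasiMeasurePreserving_fst.ae h1
  have ht : ∀ᵐ p : Point 2, p.2 ≠ 0 :=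
    Measure.quasiMeasurePreserving_snd.ae (Measure.ae_ne volume 0)
  filter_upwards [hx, ht] with p hpx hpt
  have hp : p ≠ 0 := fun h => hpt (by simp [h])
  rw [Real.norm_of_nonneg (zpow_nonneg (normN_pos hl hp).le _)]
  exact (normN_zpow_le_prod hl hpx hpt).trans (le_abs_self _)

theorem tendsto_normN_zpow (hl : l ≠ 0) :
    Tendsto (fun p => normN l p ^ (-4 : ℤ)) (𝓝[≠] 0) atTop := by
  have h0 : formD l (0 : Point 2) + rad l 0 = 0 := by simp [formD, quad, rad, formB]
  have h1 : Tendsto (fun p : Point 2 => (formD l p + rad l p) ^ 2) (𝓝[≠] 0) (𝓝[>] 0) := by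
    refine tendsto_nhdsWithin_iff.2 ⟨?_, ?_⟩
    · have : Tendsto (fun p : Point 2 => (formD l p + rad l p) ^ 2) (𝓝 0)
          (𝓝 ((formD l (0 : Point 2) + rad l 0) ^ 2)) :=
        ((continuous_formD_add_rad (l := l)).pow 2).tendsto 0
      rw [h0, zero_pow two_ne_zero] at this
      exact this.mono_left nhdsWithin_le_nhds
    · filter_upwards [self_mem_nhdsWithin] with p hp using pow_pos (formD_add_rad_pos hl hp) 2
  refine tendsto_atTop_mono' _ ?_ h1.inv_tendsto_nhdsGT_zero
  filter_upwards [self_mem_nhdsWithin] with p hp using inv_sq_le_normN_zpow hl hp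

theorem isCompact_formD_add_rad_le (hl : l ≠ 0) (C : ℝ) :
    IsCompact {p : Point 2 | formD l p + rad l p ≤ C} := by
  have hl' := abs_pos.2 hl
  refine isCompact_of_sq_le (isClosed_le continuous_formD_add_rad continuous_const)
    (max (C / |l|) (C ^ 2)) fun p (hp : formD l p + rad l p ≤ C) => ⟨fun i => ?_, ?_⟩
  · refine le_max_of_le_left ?_
    rw [le_div_iff₀ hl', mul_comm]
    exact (sq_coord_le p i).trans hp
  · refine le_max_of_le_right ?_
    have h1 := abs_snd_le_rad (l := l) p
    have h2 := formD_nonneg (l := l) p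
    rw [← sq_abs p.2]
    exact pow_le_pow_left₀ (abs_nonneg _) (by linarith) 2

theorem normN_zpow_le_one (hl : l ≠ 0) (p : Point 2)
    (hp : p ∉ {p : Point 2 | formD l p + rad l p ≤ 2}) : normN l p ^ (-4 : ℤ) ≤ 1 := by
  have hp' : 2 < formD l p + rad l p := not_le.1 hp
  have hp0 : p ≠ 0 := by
    rintro rfl
    simp [formD, quad, rad, formB] at hp'
    linarith
  refine (normN_zpow_le_two_mul hl hp0).trans ?_
  rw [← div_eq_mul_inv, div_le_one (by positivity)]
  nlinarith

end Bounds

/-! ### The gauge is not infinity-harmonic -/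

theorem gam_const_right {n : ℕ} {L : Fin n → ℝ} (f : Point n → ℝ) (c : ℝ) (p : Point n) :
    gam L f (fun _ => c) p = 0 := by simp [gam, X_const]

theorem gam_sub_right {n : ℕ} {L : Fin n → ℝ} {f g h : Point n → ℝ} {p : Point n}
    (hg : DifferentiableAt ℝ g p) (hh : DifferentiableAt ℝ h p) :
    gam L f (fun q => g q - h q) p = gam L f g p - gam L f h p := by
  simp only [gam, X_sub hg hh, ← Finset.sum_sub_distrib, mul_sub]

/-- From Γ(e^f, e^f) = e^{2f}Γ(f,f) and Δ_∞ = ½Γ(·, Γ(·,·)): the derivative of e^{2f} yields the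
square term. -/
theorem lapInf_exp {n : ℕ} {L : Fin n → ℝ} {f : Point n → ℝ} {p : Point n}
    (hf : ContDiffAt ℝ 2 f p) :
    lapInf L (fun q => Real.exp (f q)) p =
      Real.exp (f p) ^ 3 * (gam L f f p ^ 2 + 1 / 2 * gam L f (gam L f f) p) := by
  have hd := hf.differentiableAt (by simp)
  have hG : DifferentiableAt ℝ (gam L f f) p :=
    (contDiffAt_gam (m := 1) hf hf (by norm_num [one_add_one_eq_two])).differentiableAt (by simp)
  have hexp : ∀ {g : Point n → ℝ} {q}, DifferentiableAt ℝ f q →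
      gam L g (fun q => Real.exp (f q)) q = Real.exp (f q) * gam L g f q := fun hq =>
    gam_comp_right (Real.hasDerivAt_exp _) hq
  have hEE : gam L (fun q => Real.exp (f q)) (fun q => Real.exp (f q)) =ᶠ[𝓝 p]
      fun q => Real.exp (f q) * (Real.exp (f q) * gam L f f q) := by
    filter_upwards [eventually_differentiableAt hf] with q hq
    rw [hexp hq, gam_comm, hexp hq]
  rw [lapInf_eq_gam hf.exp, gam_congr (EventuallyEq.refl _ _) hEE,
    gam_comm, hexp hd, gam_comm, gam_mul_right hd.exp (hd.exp.fun_mul hG),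
    gam_mul_right hd.exp hG, hexp hd]
  ring

/-- The point `(1, 1, 0, 0; 0)`. -/
def diagPoint : Point 2 := (Sum.elim ![1, 1] ![0, 0], 0)

theorem diagPoint_ne_zero : diagPoint ≠ 0 := by
  intro h
  have := congrFun (congrArg Prod.fst h) (Sum.inl 0)
  simp [diagPoint] at this

theorem lapInf_normN_diagPoint {L : Fin 2 → ℝ} (hl : L 0 ≠ 0) (hL : L 1 = 2 * L 0) :
    lapInf L (normN (L 0)) diagPoint ≠ 0 := by
  have hp := diagPoint_ne_zero
  have hla := abs_pos.2 hl
  have h : normN (L 0) =ᶠ[𝓝 diagPoint] fun q => Real.exp (logN (L 0) q) := by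
    filter_upwards [isOpen_compl_singleton.mem_nhds hp] with q hq using normN_eq_exp hl hq
  rw [lapInf_congr h, lapInf_exp (contDiffAt_logN hl hp)]
  refine mul_ne_zero (pow_pos (Real.exp_pos _) 3).ne' (ne_of_gt ?_)
  have hB : formB (L 0) diagPoint = 3 / 2 * |L 0| := by
    simp [formB, diagPoint]; ring
  have hD : formD (L 0) diagPoint = 1 / 2 * |L 0| := by
    simp [formD, quad, diagPoint]; ring
  -- At t = 0 the radius R is B, so every quantity below is a rational multiple of a power of |L₁|.
  have hR : rad (L 0) diagPoint = 3 / 2 * |L 0| := by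
    rw [rad, hB, show diagPoint.2 = 0 from rfl, zero_pow two_ne_zero, add_zero,
      Real.sqrt_sq (by positivity)]
  have dR : DifferentiableAt ℝ (rad (L 0)) diagPoint :=
    (contDiffAt_rad hl hp (m := 1)).differentiableAt (by simp)
  have dB : DifferentiableAt ℝ (formB (L 0)) diagPoint :=
    (contDiff_formB (m := 1)).differentiable (by simp) _
  have dD : DifferentiableAt ℝ (formD (L 0)) diagPoint :=
    (contDiff_formD (m := 1)).differentiable (by simp) _
  have dG : DifferentiableAt ℝ (gam L (logN (L 0)) (logN (L 0))) diagPoint :=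
    (contDiffAt_gam (m := 1) (contDiffAt_logN hl hp (m := 2)) (contDiffAt_logN hl hp (m := 2))
      (by norm_num [one_add_one_eq_two])).differentiableAt (by simp)
  have gB : gam L (logN (L 0)) (formB (L 0)) diagPoint = 37 / 24 * |L 0| := by
    rw [gam_comm, gam_logN hl hp, gam_comm _ (formD _), gam_comm (formD _), gam_formB_formB,
      gam_formB_rad hl hp, gam_formB_formD, hB, hD, hR]
    field_simp
    norm_num
  have gD : gam L (logN (L 0)) (formD (L 0)) diagPoint = 11 / 24 * |L 0| := by
    rw [gam_comm, gam_logN hl hp, gam_comm _ (formB _), gam_formD_formD,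
      gam_formD_rad hl hp, gam_formB_formD, hB, hD, hR]
    field_simp
    norm_num
  have gR : gam L (logN (L 0)) (rad (L 0)) diagPoint = 37 / 24 * |L 0| := by
    rw [gam_comm, gam_logN hl hp, gam_comm _ (formB _), gam_comm _ (formD _),
      gam_rad_rad hl hL hp, gam_formB_rad hl hp, gam_formD_rad hl hp, hB, hD, hR]
    field_simp
    norm_num
  have hG : gam L (logN (L 0)) (logN (L 0)) diagPoint = 290 / 576 := by
    rw [gam_logN_logN hl hL hp, hB, hD, hR]
    field_simp
    norm_num
  -- Clearing the denominator near the point lets the Leibniz rule produce a linear equation for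
  -- Γ(log N, Γ(log N, log N)), without differentiating a quotient.
  have hmul : (fun q => gam L (logN (L 0)) (logN (L 0)) q *
      (16 * (rad (L 0) q * rad (L 0) q) * (formB (L 0) q + rad (L 0) q) *
        (formD (L 0) q + rad (L 0) q))) =ᶠ[𝓝 diagPoint] fun q => |L 0| *
    ((2 * formB (L 0) q - formD (L 0) q) * rad (L 0) q * (formD (L 0) q + rad (L 0) q) +
      3 * formB (L 0) q * rad (L 0) q * (formB (L 0) q + rad (L 0) q) +
      6 * (formD (L 0) q * formB (L 0) q + 2 * formB (L 0) q * rad (L 0) q -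
        formD (L 0) q * rad (L 0) q) * (formB (L 0) q + rad (L 0) q)) := by
    filter_upwards [isOpen_compl_singleton.mem_nhds hp] with q hq
    have r0 := (rad_pos hl hq).ne'
    have q0 := (formD_add_rad_pos hl hq).ne'
    have p0 := (formB_add_rad_pos hl hq).ne'
    rw [gam_logN_logN hl hL hq]
    field_simp
  have key := gam_congr (L := L) (EventuallyEq.refl _ (logN (L 0))) hmul
  simp (disch := fun_prop) only [gam_mul_right, gam_add_right, gam_sub_right, gam_const_right,
    gB, gD, gR, hB, hD, hR, hG] at key
  have hla4 : |L 0| ^ 4 ≠ 0 := by positivity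
  have hval : gam L (logN (L 0)) (gam L (logN (L 0)) (logN (L 0))) diagPoint =
      -(2 * 10444 / 41472) := by
    refine mul_left_cancel₀ hla4 ?_
    linarith
  -- The value is (290/576)² − 10444/41472 = 548/331776 > 0, with |L₁| cancelled.
  rw [hval, hG]
  norm_num

/-! ### The main theorem -/

/-- Polarizability allows any Folland solution u, so uniqueness is needed to identify it with
CN^{-4}. Then u^{-1/4} = C^{-1/4}N, and Δ_∞ is homogeneous of degree three, so the constant does not
affect vanishing. -/
theorem not_isPolarizable {L : Fin 2 → ℝ} (hl : L 0 ≠ 0) (hL : L 1 = 2 * L 0) {C : ℝ}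
    (hC : 0 < C) (h : IsFollandSolution L fun p => C * normN (L 0) p ^ (-4 : ℤ)) :
    ¬ IsPolarizable L := by
  rintro ⟨u, hu, hinf⟩
  have huniq := h.unique two_pos hu fun p hp =>
    mul_pos hC (zpow_pos (normN_pos hl hp) _)
  have hp := diagPoint_ne_zero
  have he : (fun q => u q ^ (1 / (2 - homDim 2))) =ᶠ[𝓝 diagPoint]
      fun q => C ^ (-(1 / 4) : ℝ) * Real.exp (logN (L 0) q) := by
    filter_upwards [isOpen_compl_singleton.mem_nhds hp] with q hq
    rw [huniq q hq, normN_zpow_eq_exp hl hq, Real.mul_rpow hC.le (Real.exp_pos _).le,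
      ← Real.exp_mul, show 1 / (2 - homDim 2) = (-(1 / 4) : ℝ) by norm_num [homDim]]
    congr 2
    ring
  have hN : normN (L 0) =ᶠ[𝓝 diagPoint] fun q => Real.exp (logN (L 0) q) := by
    filter_upwards [isOpen_compl_singleton.mem_nhds hp] with q hq using normN_eq_exp hl hq
  have h0 := hinf diagPoint hp
  rw [lapInf_congr he, lapInf_const_mul (contDiffAt_logN hl hp).exp, ← lapInf_congr hN] at h0
  exact mul_ne_zero (pow_pos (Real.rpow_pos_of_pos hC _) 3).ne'
    (lapInf_normN_diagPoint hl hL) h0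

end AnisoHeis

theorem theorem4p3 (L : Fin 2 → ℝ) (hL₁ : L 0 ≠ 0) (hL₂ : L 1 = 2 * L 0) :
    (∃ C : ℝ, 0 < C ∧
      AnisoHeis.IsFollandSolution L (fun p => C * AnisoHeis.normN (L 0) p ^ (-4 : ℤ)) ∧
      ∀ u : AnisoHeis.Point 2 → ℝ, AnisoHeis.IsFollandSolution L u →
        ∀ p : AnisoHeis.Point 2, p ≠ 0 → u p = C * AnisoHeis.normN (L 0) p ^ (-4 : ℤ)) ∧
    (∃ p : AnisoHeis.Point 2, p ≠ 0 ∧ AnisoHeis.lapInf L (AnisoHeis.normN (L 0)) p ≠ 0) ∧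
    ¬ AnisoHeis.IsPolarizable L := by
  open AnisoHeis in
  obtain ⟨C, hC, hF⟩ := exists_isFollandSolution (L := L) two_pos (contDiffOn_normN_zpow hL₁)
    (isHomog_normN_zpow hL₁) (fun p hp => zpow_pos (normN_pos hL₁ hp) _)
    (fun p hp => lap2_normN_zpow hL₁ hL₂ hp) (locallyIntegrable_normN_zpow hL₁)
    (tendsto_normN_zpow hL₁) (isCompact_formD_add_rad_le hL₁ 2) (normN_zpow_le_one hL₁)
  exact ⟨⟨C, hC, hF, fun u hu => hF.unique two_pos hu fun p hp =>
      mul_pos hC (zpow_pos (AnisoHeis.normN_pos hL₁ hp) _)⟩,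
    ⟨AnisoHeis.diagPoint, AnisoHeis.diagPoint_ne_zero,
      AnisoHeis.lapInf_normN_diagPoint hL₁ hL₂⟩,
    AnisoHeis.not_isPolarizable hL₁ hL₂ hC hF⟩
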